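/- Let $G=\mathrm{SO}_0(4,1)$ be the identity component of the pseudo-orthogonal group of the quadratic form $-x^0x^4+(x^1)^2+(x^2)^2+(x^3)^2$ on $\mathbb{R}^5$, let $\mathfrak g$ be its Lie algebra and $\omega=(\omega^i_j)_{0\le i,j\le 4}=g^{-1}dg$ its Maurer--Cartan form. Consider the basis of $\mathfrak g^*$ $$\alpha^1=\omega^1_0,\ \alpha^2=\omega^2_0,\ \beta^1=\omega^0_0,\ \beta^2=\omega^0_1,\ \beta^3=\omega^0_2,\ \beta^4=\omega^2_1,\ \gamma^1=\omega^0_3,\ \gamma^2=\omega^3_0,\ \gamma^3=\omega^1_0-\omega^3_1,\ \gamma^4=\omega^2_0+\omega^3_2,$$ with dual basis $(A_1,A_2,B_1,\dots,B_4,C_1,\dots,C_4)$ of $\mathfrak g$, and set $\mathfrak a=\mathrm{span}\{A_1,A_2\}$, $\mathfrak b=\mathrm{span}\{B_1,\dots,B_4,C_1,\dots,C_4\}$, so that $\mathfrak g=\mathfrak a\oplus\mathfrak b$. For $q\in\mathbb{R}^2$, $p\in\mathbb{R}^3$ let $Q(q,p)\in\mathrm{Hom}(\mathfrak a,\mathfrak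 b)$ be $$Q(q,p)=q_1(B_4\otimes\alpha^1+2B_1\otimes\alpha^2)+q_2(-2B_1\otimes\alpha^1+B_4\otimes\alpha^2)+p_1B_2\otimes\alpha^1+p_2(-B_3\otimes\alpha^1+B_2\otimes\alpha^2)+p_3B_3\otimes\alpha^2 .$$ For real constants $a,b_1,b_2$ let $$\mathbf M_{(a,b_1,b_2)}=\{Q(q,(t\cos a+b_1,\,p_2,\,t\sin a+b_2)) : q\in\mathbb{R}^2,\ t,p_2\in\mathbb{R}\}\subset\mathrm{Hom}(\mathfrak a,\mathfrak b),$$ an affine subspace whose direction is denoted by $\vec{\mathbf M}$. Then, for all real $a,b_1,b_2$: 1. $\mathbf M_{(a,b_1,b_2)}$ is a $4$-dimensional involutive affine tableau, that is, $\vec{\mathbf M}$ is involutive: $\dim\vec{\mathbf M}^{(1)}=s_1+2s_2$. The characters of $\vec{\mathbf M}$ are $s_1=4$, $s_2=0$. 2. For every $Q\in\mathbf M_{(a,b_1,b_2)}$ the element $\tau(Q)\in\mathfrak b\otimes\Lambda^2(\mathfrak a^*)$, $$\tau(Q)(x,y)=[x+Qx,\,y+Qy]_{\mathfrak b}-Q\big([x+Qx,\,y+Qy]_{\mathfrak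 a}\big),$$ lies in the image of the Spencer coboundary $\delta^{1,1}:\mathrm{Hom}(\mathfrak a,\vec{\mathbf M})\to\mathfrak b\otimes\Lambda^2(\mathfrak a^*)$, $\delta^{1,1}(F)(x,y)=\frac12\big(F(x)(y)-F(y)(x)\big)$; that is, $\mathbf M_{(a,b_1,b_2)}$ is an affine tableau over $\mathfrak g$. 3. The associated Pfaffian differential system on $Y=G\times\mathbf M_{(a,b_1,b_2)}$, generated as a differential ideal by the $1$-forms which at $(g,Q)$ are $$\eta^j=\beta^j-\sum_{i=1}^2\beta^j(Q(A_i))\,\alpha^i\ (j=1,\dots,4),\qquad \gamma^1,\dots,\gamma^4,$$ with independence condition $\alpha^1\wedge\alpha^2\ne0$, has linearly independent generators $\eta^j,\gamma^j$, which are also independent of $\alpha^1,\alpha^2$; it is linear (the exterior derivatives of the generators vanish modulo the generators and $\alpha^1,\alpha^2$) and in involution (at every point of $Y$ there is an ordinary integral element on which $\alpha^1\wedge\alpha^2\neq0$). Its Cartan characters, computed from any ordinary integral flag whose $2$-dimensional integral element satisfies the independence condition, are $s_0=8$, $s_1=4$, $s_2=0$. -/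

import Mathlib

open scoped Matrix Topology

noncomputable section

/-! ## Tableaux -/

namespace Tableau

section Linear

variable {U V : Type*} [AddCommGroup U] [Module ℝ U] [AddCommGroup V] [Module ℝ V]

/-- `Ker (A, S)`: the elements of the tableau `A ⊆ Hom(U, V)` that vanish on the subspace `S`. -/
def kerOn (A : Submodule ℝ (U →ₗ[ℝ] V)) (S : Submodule ℝ U) : Submodule ℝ (U →ₗ[ℝ] V) where
  carrier := {Q | Q ∈ A ∧ ∀ u ∈ S, Q u = 0}
  add_mem' := fun {P Q} hP hQ =>
    ⟨A.add_mem hP.1 hQ.1, fun u hu => by simp [hP.2 u hu, hQ.2 u hu]⟩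
  zero_mem' := ⟨A.zero_mem, fun u _ => by simp⟩
  smul_mem' := fun c {Q} hQ => ⟨A.smul_mem c hQ.1, fun u hu => by simp [hQ.2 u hu]⟩

/-- The dimension of `Ker (A, S)` for a generic `j`-dimensional subspace `S`, i.e. the minimum of
`dim Ker (A, S)` over all `j`-dimensional subspaces `S`. -/
def genericKerDim (A : Submodule ℝ (U →ₗ[ℝ] V)) (j : ℕ) : ℕ :=
  sInf {d | ∃ S : Submodule ℝ U, Module.finrank ℝ S = j ∧ Module.finrank ℝ (kerOn A S) = d}

/-- The character `s_j` of a tableau (`1 ≤ j ≤ dim U`), characterized by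
`s_1 + ⋯ + s_j = codim Ker (A, S)` for `S` generic of dimension `j`. The subtraction is never
truncated, since `genericKerDim` is non-increasing on `0, …, dim U`. -/
def character (A : Submodule ℝ (U →ₗ[ℝ] V)) (j : ℕ) : ℕ :=
  genericKerDim A (j - 1) - genericKerDim A j

/-- The Spencer coboundary `δ^{1,1}(F)(u, v) = (F(u)(v) - F(v)(u)) / 2` for `F ∈ Hom(U, A)`. Elements
of `V ⊗ Λ²(U*)` are regarded as (alternating) bilinear maps. -/
def spencer (A : Submodule ℝ (U →ₗ[ℝ] V)) : (U →ₗ[ℝ] A) →ₗ[ℝ] (U →ₗ[ℝ] U →ₗ[ℝ] V) where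
  toFun F := (1 / 2 : ℝ) • (A.subtype ∘ₗ F - (A.subtype ∘ₗ F).flip)
  map_add' F G := by
    ext u v
    simp only [LinearMap.smul_apply, LinearMap.sub_apply, LinearMap.flip_apply,
      LinearMap.comp_apply, LinearMap.add_apply, map_add]
    module
  map_smul' c F := by
    ext u v
    simp only [LinearMap.smul_apply, LinearMap.sub_apply, LinearMap.flip_apply,
      LinearMap.comp_apply, map_smul, RingHom.id_apply]
    module

/-- The first prolongation `A⁽¹⁾ = ker δ^{1,1}`. -/
def prolongation (A : Submodule ℝ (U →ₗ[ℝ] V)) : Submodule ℝ (U →ₗ[ℝ] A) :=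
  LinearMap.ker (spencer A)

/-- A tableau is involutive if `dim A⁽¹⁾ = s_1 + 2 s_2 + ⋯ + n s_n`. -/
def IsInvolutive (A : Submodule ℝ (U →ₗ[ℝ] V)) : Prop :=
  Module.finrank ℝ (prolongation A) =
    ∑ j ∈ Finset.Icc 1 (Module.finrank ℝ U), j * character A j

end Linear

section OverLieAlgebra

variable {L : Type*} [LieRing L] [LieAlgebra ℝ L] {𝔞 𝔟 : Submodule ℝ L}

/-- The polynomial map
`τ(Q)(x, y) = [x + Q x, y + Q y]_𝔟 - Q ([x + Q x, y + Q y]_𝔞)`, where `𝔤 = 𝔞 ⊕ 𝔟`. -/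
def tau (h : IsCompl 𝔞 𝔟) (Q : 𝔞 →ₗ[ℝ] 𝔟) (x y : 𝔞) : 𝔟 :=
  𝔟.projectionOnto 𝔞 h.symm ⁅(x : L) + (Q x : L), (y : L) + (Q y : L)⁆ -
    Q (𝔞.projectionOnto 𝔟 h ⁅(x : L) + (Q x : L), (y : L) + (Q y : L)⁆)

/-- An affine subspace `𝔸 ⊆ Hom(𝔞, 𝔟)` is involutive if its direction (the tableau of which it is
a translate) is an involutive tableau. -/
def IsInvolutiveAffine (𝔸 : AffineSubspace ℝ (𝔞 →ₗ[ℝ] 𝔟)) : Prop :=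
  (𝔸 : Set (𝔞 →ₗ[ℝ] 𝔟)).Nonempty ∧ IsInvolutive 𝔸.direction

/-- An affine tableau over the Lie algebra `𝔤 = 𝔞 ⊕ 𝔟`: an involutive affine subspace
`𝔸 ⊆ Hom(𝔞, 𝔟)` such that `τ(Q) ∈ Im δ^{1,1}` for every `Q ∈ 𝔸`. If `𝔸` is a linear subspace, this
is the notion of a tableau over `𝔤`. -/
def IsAffineTableauOver (h : IsCompl 𝔞 𝔟) (𝔸 : AffineSubspace ℝ (𝔞 →ₗ[ℝ] 𝔟)) : Prop :=
  IsInvolutiveAffine 𝔸 ∧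
    ∀ Q ∈ 𝔸, ∃ F : 𝔞 →ₗ[ℝ] 𝔸.direction, ∀ x y : 𝔞, tau h Q x y = spencer 𝔸.direction F x y

end OverLieAlgebra

end Tableau

/-! ## Pfaffian systems on embedded submanifolds -/

/-- The tangent space at `z` of an embedded submanifold `Z` of a normed space. -/
def embTangent {W : Type*} [NormedAddCommGroup W] [NormedSpace ℝ W] (Z : Set W) (z : W) :
    Submodule ℝ W :=
  Submodule.span ℝ (tangentConeAt ℝ Z z)

/-- `z` is an ordinary zero of a family `f` of smooth functions on an embedded submanifold `Z`:
it is a common zero, and near `z` the common zero locus in `Z` is cut out by finitely many members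
of the family whose differentials on `Z` are linearly independent at `z`.
(The functions are given by extensions to a neighbourhood of `Z`.) -/
def IsOrdinaryZero {W : Type*} [NormedAddCommGroup W] [NormedSpace ℝ W] {ι : Type*} (Z : Set W)
    (f : ι → W → ℝ) (z : W) : Prop :=
  z ∈ Z ∧ (∀ i, f i z = 0) ∧ ∃ (c : ℕ) (k : Fin c → ι),
    (∀ᶠ z' in 𝓝[Z] z, (∀ i, f (k i) z' = 0) → ∀ i, f i z' = 0) ∧
    LinearIndependent ℝ fun i => (fderiv ℝ (f (k i)) z).toLinearMap.domRestrict (embTangent Z z)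

/-- Data for a Pfaffian system `(I, ω)` on an embedded submanifold `Y` of a normed space `W`: `I` is
the differential ideal generated by the restrictions to `Y` of the `1`-forms `θ a`, and
`ω = ω 1 ∧ ⋯ ∧ ω n` is the independence condition. All forms are given by extensions to a
neighbourhood of `Y` in `W`. -/
structure PfaffianSystem (W : Type*) [NormedAddCommGroup W] [NormedSpace ℝ W] (s n : ℕ) where
  /-- the underlying submanifold -/
  carrier : Set W
  /-- the generating `1`-forms -/
  θ : Fin s → W → W →L[ℝ] ℝ
  /-- the `1`-forms of the independence condition -/
  ω : Fin n → W → W →L[ℝ] ℝ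

theorem twoForm_add {W : Type*} [NormedAddCommGroup W] [NormedSpace ℝ W] (Ω : W [⋀^Fin 2]→L[ℝ] ℝ)
    (w u v : W) : Ω ![w, u + v] = Ω ![w, u] + Ω ![w, v] := by
  have e : ∀ x : W, Function.update ![w, 0] 1 x = ![w, x] := fun x => by
    ext i
    fin_cases i <;> simp
  have h := Ω.map_update_add ![w, 0] 1 u v
  rwa [e, e, e] at h

theorem twoForm_smul {W : Type*} [NormedAddCommGroup W] [NormedSpace ℝ W] (Ω : W [⋀^Fin 2]→L[ℝ] ℝ)
    (c : ℝ) (w u : W) : Ω ![w, c • u] = c * Ω ![w, u] := by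
  have e : ∀ x : W, Function.update ![w, 0] 1 x = ![w, x] := fun x => by
    ext i
    fin_cases i <;> simp
  have h := Ω.map_update_smul ![w, 0] 1 c u
  rwa [e, e] at h

namespace PfaffianSystem

variable {W : Type*} [NormedAddCommGroup W] [NormedSpace ℝ W] {s n : ℕ}

/-- The tangent space of the underlying manifold. -/
def tangent (S : PfaffianSystem W s n) (y : W) : Submodule ℝ W :=
  embTangent S.carrier y

/-- The exterior derivative of `θ a`. -/
def dθ (S : PfaffianSystem W s n) (a : Fin s) (y u v : W) : ℝ :=
  extDeriv (fun x => ContinuousAlternatingMap.ofSubsingleton ℝ W ℝ (0 : Fin 1) (S.θ a x)) y ![u, v]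

/-- The `1`-forms `θ a` and `ω i` are linearly independent at each point of the manifold. -/
def IndependentForms (S : PfaffianSystem W s n) : Prop :=
  ∀ y ∈ S.carrier, LinearIndependent ℝ
    (Sum.elim (fun a => (S.θ a y).toLinearMap.domRestrict (S.tangent y))
      (fun i => (S.ω i y).toLinearMap.domRestrict (S.tangent y)))

/-- The system is linear: `dθ a ≡ 0 mod {θ, ω}`, that is, each `dθ a` vanishes on pairs of tangent
vectors annihilated by all the `θ b` and `ω i`. -/
def IsLinear (S : PfaffianSystem W s n) : Prop :=
  ∀ y ∈ S.carrier, ∀ u ∈ S.tangent y, ∀ v ∈ S.tangent y,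
    (∀ b, S.θ b y u = 0) → (∀ b, S.θ b y v = 0) → (∀ i, S.ω i y u = 0) → (∀ i, S.ω i y v = 0) →
      ∀ a, S.dθ a y u v = 0

/-- The bundle of `p`-frames: pairs of a point `y` and linearly independent tangent vectors
`e_1, …, e_p` at `y`. The frame represents the `p`-plane that it spans. -/
def frames (S : PfaffianSystem W s n) (p : ℕ) : Set (W × (Fin p → W)) :=
  {z | z.1 ∈ S.carrier ∧ LinearIndependent ℝ z.2 ∧ ∀ i, z.2 i ∈ S.tangent z.1}

/-- The functions on `p`-frames whose common zeros are the frames of integral elements: the values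
of the `θ a` and `dθ a` on the vectors of the frame. -/
def integralEqs (S : PfaffianSystem W s n) (p : ℕ) :
    (Fin s × Fin p) ⊕ (Fin s × Fin p × Fin p) → W × (Fin p → W) → ℝ
  | .inl (a, i), z => S.θ a z.1 (z.2 i)
  | .inr (a, i, j), z => S.dθ a z.1 (z.2 i) (z.2 j)

/-- The frame spans a `p`-dimensional integral element. -/
def IsIntegral (S : PfaffianSystem W s n) {p : ℕ} (z : W × (Fin p → W)) : Prop :=
  z ∈ S.frames p ∧ ∀ k, S.integralEqs p k z = 0

/-- The polar space `H(E)` of the integral element `E` spanned by the frame. -/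
def polar (S : PfaffianSystem W s n) {p : ℕ} (z : W × (Fin p → W)) : Submodule ℝ W where
  carrier := {v | v ∈ S.tangent z.1 ∧ (∀ a, S.θ a z.1 v = 0) ∧ ∀ a i, S.dθ a z.1 (z.2 i) v = 0}
  add_mem' := by
    rintro u v ⟨hu, hu', hu''⟩ ⟨hv, hv', hv''⟩
    refine ⟨add_mem hu hv, fun a => by rw [map_add, hu', hv', add_zero], fun a i => ?_⟩
    have h1 := hu'' a i
    have h2 := hv'' a i
    rw [dθ] at h1 h2 ⊢
    rw [twoForm_add, h1, h2, add_zero]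
  zero_mem' := by
    refine ⟨zero_mem _, fun a => map_zero _, fun a i => ?_⟩
    exact (extDeriv _ z.1).map_coord_zero 1 (by simp)
  smul_mem' := by
    rintro c u ⟨hu, hu', hu''⟩
    refine ⟨Submodule.smul_mem _ c hu, fun a => by rw [map_smul, hu', smul_zero], fun a i => ?_⟩
    have h1 := hu'' a i
    rw [dθ] at h1 ⊢
    rw [twoForm_smul, h1, mul_zero]

/-- The integral element spanned by the frame is Kähler-regular: it is an ordinary zero of the
equations of integral elements, and the dimension of the polar space is locally constant on integral
elements. -/
def IsKahlerRegular (S : PfaffianSystem W s n) {p : ℕ} (z : W × (Fin p → W)) : Prop :=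
  IsOrdinaryZero (S.frames p) (S.integralEqs p) z ∧
    ∀ᶠ z' in 𝓝[S.frames p] z, S.IsIntegral z' →
      Module.finrank ℝ (S.polar z') = Module.finrank ℝ (S.polar z)

/-- The first `k` vectors of a frame; they span the `k`-th subspace of the flag that it defines. -/
def trunc (y : W) (e : Fin n → W) (k : ℕ) (hk : k ≤ n) : W × (Fin k → W) :=
  (y, fun i => e (Fin.castLE hk i))

/-- The flag `0 = E_0 ⊂ E_1 ⊂ ⋯ ⊂ E_n`, `E_k = span (e_1, …, e_k)`, in the tangent space at `y` is an
ordinary integral flag: `E_n` is an integral element on which `ω_1 ∧ ⋯ ∧ ω_n` does not vanish, and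
`E_k` is Kähler-regular for all `k < n`. In particular, `E_n` is then an ordinary integral
element. -/
def IsOrdinaryFlag (S : PfaffianSystem W s n) (y : W) (e : Fin n → W) : Prop :=
  S.IsIntegral (y, e) ∧ (Matrix.of fun i j => S.ω i y (e j)).det ≠ 0 ∧
    ∀ (k : ℕ) (hk : k < n), S.IsKahlerRegular (trunc y e k hk.le)

/-- The system is in involution: at each point of the manifold there is an ordinary integral element
satisfying the independence condition. -/
def InInvolution (S : PfaffianSystem W s n) : Prop :=
  ∀ y ∈ S.carrier, ∃ e : Fin n → W, S.IsOrdinaryFlag y e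

/-- `c_k`: the codimension of the polar space of `E_k` for `k < n`, and the codimension of `E_n` for
`k = n`. -/
def polarCodim (S : PfaffianSystem W s n) (y : W) (e : Fin n → W) (k : ℕ) : ℤ :=
  if hk : k < n then
    (Module.finrank ℝ (S.tangent y) : ℤ) - Module.finrank ℝ (S.polar (trunc y e k hk.le))
  else (Module.finrank ℝ (S.tangent y) : ℤ) - n

/-- The Cartan character `s_k` of an integral flag: `s_0 = c_0` and `s_k = c_k - c_{k-1}`
for `1 ≤ k ≤ n`. -/
def cartanCharacter (S : PfaffianSystem W s n) (y : W) (e : Fin n → W) : ℕ → ℤ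
  | 0 => S.polarCodim y e 0
  | k + 1 => S.polarCodim y e (k + 1) - S.polarCodim y e k

/-- All ordinary integral flags of the system have the Cartan characters `c 0, …, c n`. -/
def HasCartanCharacters (S : PfaffianSystem W s n) (c : Fin (n + 1) → ℤ) : Prop :=
  ∀ y ∈ S.carrier, ∀ e : Fin n → W, S.IsOrdinaryFlag y e →
    ∀ k : Fin (n + 1), S.cartanCharacter y e k = c k

end PfaffianSystem

/-! ## The Möbius group and its Lie algebra -/

namespace Moebius

/-- Real `5 × 5` matrices; rows and columns are numbered `0, …, 4`, and `X i j` is `X^i_j`. -/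
abbrev Mat : Type := Matrix (Fin 5) (Fin 5) ℝ

/-- The Gram matrix of the quadratic form `-x⁰x⁴ + (x¹)² + (x²)² + (x³)²`. -/
def gram : Mat :=
  !![0, 0, 0, 0, -1 / 2;
     0, 1, 0, 0, 0;
     0, 0, 1, 0, 0;
     0, 0, 0, 1, 0;
     -1 / 2, 0, 0, 0, 0]

/-- `G = SO₀(4,1)`, the identity component of the pseudo-orthogonal group. -/
def group : Set Mat :=
  connectedComponentIn {g : Mat | gᵀ * gram * g = gram} 1

attribute [local instance 100] LieRing.ofAssociativeRing

/-- The Lie algebra `𝔤 ≅ 𝔰𝔬(4,1)` of `G`. -/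
abbrev lieAlg : LieSubalgebra ℝ Mat := skewAdjointMatricesLieSubalgebra gram

/-- The linear form `X ↦ X^i_j`. -/
def entry (i j : Fin 5) : Mat →ₗ[ℝ] ℝ := Matrix.entryLinearMap ℝ ℝ i j

/-- `α¹ = ω¹₀`, `α² = ω²₀`. -/
def α : Fin 2 → Mat →ₗ[ℝ] ℝ := ![entry 1 0, entry 2 0]

/-- The eight forms `β¹ = ω⁰₀`, `β² = ω⁰₁`, `β³ = ω⁰₂`, `β⁴ = ω²₁`, followed by `γ¹ = ω⁰₃`, `γ² = ω³₀`,
`γ³ = ω¹₀ - ω³₁`, `γ⁴ = ω²₀ + ω³₂`. -/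
def βγ : Fin 8 → Mat →ₗ[ℝ] ℝ :=
  ![entry 0 0, entry 0 1, entry 0 2, entry 2 1,
    entry 0 3, entry 3 0, entry 1 0 - entry 3 1, entry 2 0 + entry 3 2]

/-- The element of `𝔤` with `αⁱ = a i` and `(β, γ)ʲ = b j`. -/
def ofCoords (a : Fin 2 → ℝ) (b : Fin 8 → ℝ) : Mat :=
  !![b 0, b 1, b 2, b 4, 0;
     a 0, 0, -b 3, b 6 - a 0, b 1 / 2;
     a 1, b 3, 0, a 1 - b 7, b 2 / 2;
     b 5, a 0 - b 6, b 7 - a 1, 0, b 4 / 2;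
     0, 2 * a 0, 2 * a 1, 2 * b 5, -b 0]

theorem mem_lieAlg_iff (X : Mat) : X ∈ lieAlg ↔ Xᵀ * gram = gram * -X := by
  rw [mem_skewAdjointMatricesLieSubalgebra, mem_skewAdjointMatricesSubmodule]
  rfl

theorem ofCoords_mem (a : Fin 2 → ℝ) (b : Fin 8 → ℝ) : ofCoords a b ∈ lieAlg := by
  rw [mem_lieAlg_iff]
  ext i j
  fin_cases i <;> fin_cases j <;>
    simp [ofCoords, gram, Matrix.mul_apply, Fin.sum_univ_succ] <;> ring

theorem ofCoords_eq {X : Mat} (hX : X ∈ lieAlg) :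
    ofCoords (fun i => α i X) (fun j => βγ j X) = X := by
  rw [mem_lieAlg_iff] at hX
  have h : ∀ i j, (Xᵀ * gram) i j = (gram * -X) i j := fun i j => by rw [hX]
  simp only [gram, Matrix.mul_apply, Fin.sum_univ_succ, Matrix.transpose_apply] at h
  have h00 := h 0 0
  have h01 := h 0 1
  have h02 := h 0 2
  have h03 := h 0 3
  have h04 := h 0 4
  have h11 := h 1 1
  have h12 := h 1 2
  have h13 := h 1 3
  have h14 := h 1 4
  have h22 := h 2 2
  have h23 := h 2 3
  have h24 := h 2 4
  have h33 := h 3 3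
  have h34 := h 3 4
  have h44 := h 4 4
  clear h hX
  simp at h00 h01 h02 h03 h04 h11 h12 h13 h14 h22 h23 h24 h33 h34 h44
  ext i j
  fin_cases i <;> fin_cases j <;> simp [ofCoords, α, βγ, entry] <;> linarith

/-- The coordinates on `𝔤` given by the forms `α, β, γ`. -/
def coordEquiv : lieAlg ≃ₗ[ℝ] (Fin 2 ⊕ Fin 8 → ℝ) where
  toFun X := Sum.elim (fun i => α i X) (fun j => βγ j X)
  map_add' X Y := by ext (i | j) <;> simp
  map_smul' c X := by ext (i | j) <;> simp
  invFun c := ⟨ofCoords (fun i => c (.inl i)) (fun j => c (.inr j)), ofCoords_mem _ _⟩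
  left_inv X := Subtype.ext (ofCoords_eq X.2)
  right_inv c := by
    ext (i | j)
    · fin_cases i <;> simp [ofCoords, α, entry]
    · fin_cases j <;> simp [ofCoords, βγ, entry]

/-- The basis `(A₁, A₂, B₁, …, B₄, C₁, …, C₄)` of `𝔤` dual to `(α, β, γ)`. -/
def basis : Module.Basis (Fin 2 ⊕ Fin 8) ℝ lieAlg := Module.Basis.ofEquivFun coordEquiv

/-- `𝔞 = span (A₁, A₂)`. -/
def 𝔞 : Submodule ℝ lieAlg := Submodule.span ℝ (Set.range fun i => basis (.inl i))

/-- `𝔟 = span (B₁, …, B₄, C₁, …, C₄)`. -/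
def 𝔟 : Submodule ℝ lieAlg := Submodule.span ℝ (Set.range fun j => basis (.inr j))

theorem isCompl : IsCompl 𝔞 𝔟 := by
  have h := basis.linearIndependent
  rw [← Sum.elim_comp_inl_inr (basis : Fin 2 ⊕ Fin 8 → lieAlg), linearIndependent_sum] at h
  refine ⟨h.2.2, ?_⟩
  rw [codisjoint_iff, 𝔞, 𝔟, ← Submodule.span_union, ← Set.Sum.elim_range,
    ← basis.span_eq]
  congr 2
  ext (i | j) <;> rfl

/-- `A₁, A₂` as elements of `𝔞`. -/
def A (i : Fin 2) : 𝔞 := ⟨basis (.inl i), Submodule.subset_span ⟨i, rfl⟩⟩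

/-- `B₁, …, B₄, C₁, …, C₄` as elements of `𝔟`. -/
def BC (j : Fin 8) : 𝔟 := ⟨basis (.inr j), Submodule.subset_span ⟨j, rfl⟩⟩

/-- `αⁱ` as a linear form on `𝔞`. -/
def αOn (i : Fin 2) : 𝔞 →ₗ[ℝ] ℝ :=
  α i ∘ₗ lieAlg.toSubmodule.subtype ∘ₗ 𝔞.subtype

/-- The rank one map `(B, C)_j ⊗ αⁱ ∈ Hom(𝔞, 𝔟)`. -/
def tens (j : Fin 8) (i : Fin 2) : 𝔞 →ₗ[ℝ] 𝔟 := (αOn i).smulRight (BC j)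

/-- The general element `Q(q, p)` of the Möbius tableau. -/
def Q (q₁ q₂ p₁ p₂ p₃ : ℝ) : 𝔞 →ₗ[ℝ] 𝔟 :=
  q₁ • (tens 3 0 + (2 : ℝ) • tens 0 1) + q₂ • (-(2 : ℝ) • tens 0 0 + tens 3 1) +
    p₁ • tens 1 0 + p₂ • (-tens 2 0 + tens 1 1) + p₃ • tens 2 1

/-- The affine tableau `M_(a,b₁,b₂)`: all `Q(q, p)` with `p₁ = t cos a + b₁` and `p₃ = t sin a + b₂`
for some real `t`. -/
def affineTableau (a b₁ b₂ : ℝ) : AffineSubspace ℝ (𝔞 →ₗ[ℝ] 𝔟) where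
  carrier := {R | ∃ q₁ q₂ t p₂ : ℝ,
    R = Q q₁ q₂ (t * Real.cos a + b₁) p₂ (t * Real.sin a + b₂)}
  smul_vsub_vadd_mem' := by
    rintro c _ _ _ ⟨q₁, q₂, t, p₂, rfl⟩ ⟨q₁', q₂', t', p₂', rfl⟩ ⟨q₁'', q₂'', t'', p₂'', rfl⟩
    refine ⟨c * (q₁ - q₁') + q₁'', c * (q₂ - q₂') + q₂'', c * (t - t') + t'',
      c * (p₂ - p₂') + p₂'', ?_⟩
    simp only [vsub_eq_sub, vadd_eq_add, Q]
    module

/-! ## The Pfaffian system associated with an affine tableau -/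

end Moebius

end

attribute [local instance] Matrix.linftyOpNormedAddCommGroup Matrix.linftyOpNormedSpace

noncomputable section

namespace Moebius

/-- The space `Mat × Hom(𝔞, 𝔟)` in which `G × Hom(𝔞, 𝔟)` is embedded; `R ∈ Hom(𝔞, 𝔟)` is given by
its matrix with respect to the bases `A` of `𝔞` and `BC` of `𝔟`. -/
abbrev Ambient : Type := Mat × (Fin 8 → Fin 2 → ℝ)

/-- The Maurer-Cartan form `g⁻¹ dg`, pulled back to `Mat × Hom(𝔞, 𝔟)`. -/
def mc (y : Ambient) : Ambient →ₗ[ℝ] Mat :=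
  LinearMap.mulLeft ℝ (y.1⁻¹) ∘ₗ LinearMap.fst ℝ Mat (Fin 8 → Fin 2 → ℝ)

/-- The Pfaffian system associated with an affine subspace `𝔸 ⊆ Hom(𝔞, 𝔟)`: it lives on
`Y = G × 𝔸`, and is generated by the components of `ω_𝔟 - R ∘ ω_𝔞` at `(g, R) ∈ Y`, with independence
condition `α¹ ∧ α² ≠ 0`. If the elements of `𝔸` take values in `span (B₁, …, B₄)`, the generators are
`ηʲ = βʲ - ∑ i, Rʲ_i αⁱ` and `γ¹, …, γ⁴`. -/
def system (𝔸 : AffineSubspace ℝ (𝔞 →ₗ[ℝ] 𝔟)) : PfaffianSystem Ambient 8 2 where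
  carrier := {y | y.1 ∈ group ∧ ∃ R ∈ 𝔸, ∀ j i, y.2 j i = βγ j ((R (A i) : lieAlg) : Mat)}
  θ j y := LinearMap.toContinuousLinearMap ((βγ j - ∑ i, y.2 j i • α i) ∘ₗ mc y)
  ω i y := LinearMap.toContinuousLinearMap (α i ∘ₗ mc y)

end Moebius

end

open scoped Matrix Topology

noncomputable section

namespace Moebius

attribute [local instance 100] LieRing.ofAssociativeRing

/-! ### Coordinates on `𝔞` and `𝔟` -/

/-! Everything rests on one `4 × 4` matrix. In the parameters `(q₁, q₂, t, p₂)` and the coordinates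
`β¹, …, β⁴`, evaluation of the direction at a vector `ξ` of `𝔞` (`dirEval`) splits into two `2 × 2`
blocks, with determinants `2 (ξ₀² + ξ₁²)` and `cos a ξ₀² + sin a ξ₁²` (`charForm`) up to sign. Since
`cos a` and `sin a` never vanish together, a noncharacteristic `ξ` exists, and evaluation there is
bijective (`dirEval_injective`, `dirEval_surjective`). Hence an element of the direction is
determined by its value at one such `ξ`, which gives `s₁ = 4` and `s₂ = 0`. Solving the symmetry
equations directly gives a first prolongation of dimension `4 = s₁ + 2 s₂`.

The torsion is alternating on a two-dimensional space, so it is a single vector. A bracket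
computation shows that its `γ` components vanish for every `Q(q, p)` (`graphTorsion_coordMat`), and
the Spencer coboundary of the direction reaches every value of the `β` components
(`exists_skew_eq`).

On `Y`, of dimension `10 + 4`, the common kernel of the generators is parametrized by `ℝ² × ℝ⁴`
(`mem_tangent_and_θ_iff`). By the Maurer-Cartan equation, the polar equations of a line over `ξ`
form a linear system with matrix `dirEval a ξ` (`forall_dθ_integralVec_iff`). For noncharacteristic
`ξ` its solutions project isomorphically to `ℝ²`, so the polar space is an integral plane. The
codimensions `8, 12, 12` give the characters `8, 4, 0`. A Kähler-regular characteristic line has the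
same polar dimension, being a limit of noncharacteristic ones (`finrank_polar_of_isKahlerRegular`).
-/

theorem coordEquiv_basis (k : Fin 2 ⊕ Fin 8) : coordEquiv (basis k) = Pi.single k 1 := by
  rw [basis, Module.Basis.coe_ofEquivFun, LinearEquiv.apply_symm_apply]

theorem α_basis (i : Fin 2) (k : Fin 2 ⊕ Fin 8) :
    α i (basis k : Mat) = (Pi.single k 1 : Fin 2 ⊕ Fin 8 → ℝ) (.inl i) :=
  congrFun (coordEquiv_basis k) (.inl i)

theorem βγ_basis (j : Fin 8) (k : Fin 2 ⊕ Fin 8) :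
    βγ j (basis k : Mat) = (Pi.single k 1 : Fin 2 ⊕ Fin 8 → ℝ) (.inr j) :=
  congrFun (coordEquiv_basis k) (.inr j)

theorem βγ_of_mem_𝔞 (j : Fin 8) {x : lieAlg} (hx : x ∈ 𝔞) : βγ j (x : Mat) = 0 := by
  have h : 𝔞 ≤ LinearMap.ker (βγ j ∘ₗ lieAlg.toSubmodule.subtype) := by
    rw [𝔞, Submodule.span_le]
    rintro _ ⟨i, rfl⟩
    exact (βγ_basis j (.inl i)).trans (by simp)
  exact h hx

theorem α_of_mem_𝔟 (i : Fin 2) {x : lieAlg} (hx : x ∈ 𝔟) : α i (x : Mat) = 0 := by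
  have h : 𝔟 ≤ LinearMap.ker (α i ∘ₗ lieAlg.toSubmodule.subtype) := by
    rw [𝔟, Submodule.span_le]
    rintro _ ⟨j, rfl⟩
    exact (α_basis i (.inr j)).trans (by simp)
  exact h hx

theorem ext_coords {X Y : Mat} (hX : X ∈ lieAlg) (hY : Y ∈ lieAlg) (hα : ∀ i, α i X = α i Y)
    (hβγ : ∀ j, βγ j X = βγ j Y) : X = Y := by
  rw [← ofCoords_eq hX, ← ofCoords_eq hY]
  simp only [hα, hβγ]

/-- The coordinates `(β, γ)` on `𝔟`. -/
def coordB : 𝔟 →ₗ[ℝ] (Fin 8 → ℝ) :=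
  LinearMap.pi fun j => βγ j ∘ₗ lieAlg.toSubmodule.subtype ∘ₗ 𝔟.subtype

theorem coordB_apply (b : 𝔟) (j : Fin 8) : coordB b j = βγ j ((b : lieAlg) : Mat) := rfl

theorem αOn_apply (i : Fin 2) (x : 𝔞) : αOn i x = α i ((x : lieAlg) : Mat) := rfl

theorem coordB_injective : Function.Injective coordB := by
  intro b c h
  refine Subtype.ext (Subtype.ext (ext_coords b.1.2 c.1.2 (fun i => ?_) fun j => congrFun h j))
  rw [α_of_mem_𝔟 i b.2, α_of_mem_𝔟 i c.2]

@[simp]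
theorem coordB_BC (k : Fin 8) : coordB (BC k) = Pi.single k 1 := by
  ext j
  refine (βγ_basis j (.inr k)).trans ?_
  simp [Pi.single_apply]

@[simp]
theorem αOn_A (i k : Fin 2) : αOn i (A k) = (Pi.single k 1 : Fin 2 → ℝ) i := by
  refine (α_basis i (.inl k)).trans ?_
  simp [Pi.single_apply]

theorem α_ofCoords (a : Fin 2 → ℝ) (b : Fin 8 → ℝ) (i : Fin 2) : α i (ofCoords a b) = a i :=
  congrFun (coordEquiv.right_inv (Sum.elim a b)) (.inl i)

theorem βγ_ofCoords (a : Fin 2 → ℝ) (b : Fin 8 → ℝ) (j : Fin 8) : βγ j (ofCoords a b) = b j :=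
  congrFun (coordEquiv.right_inv (Sum.elim a b)) (.inr j)

theorem eq_A_add_A (x : 𝔞) : x = αOn 0 x • A 0 + αOn 1 x • A 1 := by
  refine Subtype.ext (Subtype.ext (ext_coords x.1.2 (SetLike.coe_mem _) (fun i => ?_) fun j => ?_))
  · change αOn i x = αOn i (αOn 0 x • A 0 + αOn 1 x • A 1)
    fin_cases i <;> simp
  · rw [βγ_of_mem_𝔞 j x.2, βγ_of_mem_𝔞 j (αOn 0 x • A 0 + αOn 1 x • A 1).2]

theorem finrank_𝔞 : Module.finrank ℝ 𝔞 = 2 := by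
  have h : LinearIndependent ℝ fun i : Fin 2 => basis (.inl i) :=
    basis.linearIndependent.comp _ Sum.inl_injective
  exact (finrank_span_eq_card h).trans (Fintype.card_fin 2)

/-- The matrix `(βγ j (R (A i)))` of `R = Q (q, p)`. -/
def coordMat (q₁ q₂ p₁ p₂ p₃ : ℝ) : Fin 8 → Fin 2 → ℝ :=
  ![![-2 * q₂, 2 * q₁], ![p₁, p₂], ![-p₂, p₃], ![q₁, q₂], 0, 0, 0, 0]

theorem coordB_Q (q₁ q₂ p₁ p₂ p₃ : ℝ) (x : 𝔞) (j : Fin 8) :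
    coordB (Q q₁ q₂ p₁ p₂ p₃ x) j =
      coordMat q₁ q₂ p₁ p₂ p₃ j 0 * αOn 0 x + coordMat q₁ q₂ p₁ p₂ p₃ j 1 * αOn 1 x := by
  fin_cases j <;> simp [Q, tens, coordMat] <;> ring

theorem βγ_Q_A (q₁ q₂ p₁ p₂ p₃ : ℝ) (j : Fin 8) (i : Fin 2) :
    βγ j ((Q q₁ q₂ p₁ p₂ p₃ (A i) : lieAlg) : Mat) = coordMat q₁ q₂ p₁ p₂ p₃ j i := by
  rw [← coordB_apply, coordB_Q]
  fin_cases i <;> simp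

/-! ### The torsion of an affine tableau -/

/-- The element of `𝔤` at which `α = ξ` and `(β, γ) = M ξ`. -/
def graphElt (M : Fin 8 → Fin 2 → ℝ) (ξ : Fin 2 → ℝ) : Mat :=
  ofCoords ξ fun j => M j 0 * ξ 0 + M j 1 * ξ 1

/-- The components of `[X, Y]_𝔟 - M [X, Y]_𝔞`. -/
def torsion (M : Fin 8 → Fin 2 → ℝ) (X Y : Mat) (j : Fin 8) : ℝ :=
  βγ j (X * Y - Y * X) - ∑ i, M j i * α i (X * Y - Y * X)

/-- The torsion of the graph of `M`, evaluated on `A₁, A₂`. -/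
def graphTorsion (M : Fin 8 → Fin 2 → ℝ) (j : Fin 8) : ℝ :=
  torsion M (graphElt M ![1, 0]) (graphElt M ![0, 1]) j

theorem graphElt_eq (M : Fin 8 → Fin 2 → ℝ) (ξ : Fin 2 → ℝ) :
    graphElt M ξ = ξ 0 • graphElt M ![1, 0] + ξ 1 • graphElt M ![0, 1] := by
  refine ext_coords (ofCoords_mem _ _)
    (add_mem (lieAlg.toSubmodule.smul_mem _ (ofCoords_mem _ _))
      (lieAlg.toSubmodule.smul_mem _ (ofCoords_mem _ _))) (fun i => ?_) fun j => ?_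
  · fin_cases i <;> simp [graphElt, α_ofCoords]
  · simp [graphElt, βγ_ofCoords]
    ring

/-- Alternating bilinear expressions on a plane are multiples of the determinant, and both arguments
are linear combinations of the same two graph elements. All torsion computations thus reduce to the
single vector `graphTorsion M`. -/
theorem torsion_graphElt (M : Fin 8 → Fin 2 → ℝ) (ξ η : Fin 2 → ℝ) (j : Fin 8) :
    torsion M (graphElt M ξ) (graphElt M η) j = (ξ 0 * η 1 - ξ 1 * η 0) * graphTorsion M j := by
  have h : graphElt M ξ * graphElt M η - graphElt M η * graphElt M ξ =
      (ξ 0 * η 1 - ξ 1 * η 0) • (graphElt M ![1, 0] * graphElt M ![0, 1] -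
        graphElt M ![0, 1] * graphElt M ![1, 0]) := by
    rw [graphElt_eq M ξ, graphElt_eq M η]
    simp only [add_mul, mul_add, smul_mul_assoc, mul_smul_comm]
    module
  simp only [torsion, graphTorsion, h, map_smul, smul_eq_mul, Fin.sum_univ_two]
  ring

/-- This is where the structure of `𝔰𝔬(4,1)` and the shape of `Q` enter. The identity holds for all
five parameters, with no relation between `p₁` and `p₃`; the `β` components of the torsion never
need to be computed. -/
theorem graphTorsion_coordMat (q₁ q₂ p₁ p₂ p₃ : ℝ) (j : Fin 4) :
    graphTorsion (coordMat q₁ q₂ p₁ p₂ p₃) (Fin.natAdd 4 j) = 0 := by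
  fin_cases j <;>
    simp [graphTorsion, torsion, graphElt, coordMat, ofCoords, α, βγ, entry] <;> ring

/-! ### The direction of `M_(a,b₁,b₂)` -/

/-- The linear parametrization of the direction of `M_(a,b₁,b₂)` by `(q₁, q₂, t, p₂)`. -/
def dirMap (a : ℝ) : (Fin 4 → ℝ) →ₗ[ℝ] (𝔞 →ₗ[ℝ] 𝔟) where
  toFun c := Q (c 0) (c 1) (c 2 * Real.cos a) (c 3) (c 2 * Real.sin a)
  map_add' c d := by
    simp only [Q, Pi.add_apply]
    module
  map_smul' r c := by
    simp only [Q, Pi.smul_apply, smul_eq_mul, RingHom.id_apply]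
    module

/-- The matrices of the elements of the direction of `M_(a,b₁,b₂)`. -/
def dirMat (a : ℝ) : (Fin 4 → ℝ) →ₗ[ℝ] (Fin 8 → Fin 2 → ℝ) where
  toFun c := coordMat (c 0) (c 1) (c 2 * Real.cos a) (c 3) (c 2 * Real.sin a)
  map_add' c d := by
    ext j i
    fin_cases j <;> fin_cases i <;> simp [coordMat] <;> ring
  map_smul' r c := by
    ext j i
    fin_cases j <;> fin_cases i <;> simp [coordMat] <;> ring

theorem dirMat_apply (a : ℝ) (c : Fin 4 → ℝ) :
    dirMat a c = coordMat (c 0) (c 1) (c 2 * Real.cos a) (c 3) (c 2 * Real.sin a) := rfl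

theorem coordB_dirMap (a : ℝ) (c : Fin 4 → ℝ) (x : 𝔞) (j : Fin 8) :
    coordB (dirMap a c x) j = dirMat a c j 0 * αOn 0 x + dirMat a c j 1 * αOn 1 x :=
  coordB_Q _ _ _ _ _ x j

theorem dirMat_natAdd (a : ℝ) (c : Fin 4 → ℝ) (j : Fin 4) (i : Fin 2) :
    dirMat a c (Fin.natAdd 4 j) i = 0 := by
  fin_cases j <;> fin_cases i <;> rfl

theorem dirMap_add_Q (a b₁ b₂ : ℝ) (c : Fin 4 → ℝ) (q₁ q₂ t p₂ : ℝ) :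
    dirMap a c + Q q₁ q₂ (t * Real.cos a + b₁) p₂ (t * Real.sin a + b₂) =
      Q (c 0 + q₁) (c 1 + q₂) ((c 2 + t) * Real.cos a + b₁) (c 3 + p₂)
        ((c 2 + t) * Real.sin a + b₂) := by
  change Q _ _ _ _ _ + _ = _
  simp only [Q]
  module

theorem direction_affineTableau (a b₁ b₂ : ℝ) :
    (affineTableau a b₁ b₂).direction = LinearMap.range (dirMap a) := by
  have h0 : Q 0 0 (0 * Real.cos a + b₁) 0 (0 * Real.sin a + b₂) ∈ affineTableau a b₁ b₂ :=
    ⟨0, 0, 0, 0, rfl⟩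
  ext R
  rw [AffineSubspace.mem_direction_iff_eq_vsub_right h0, LinearMap.mem_range]
  constructor
  · rintro ⟨_, ⟨q₁, q₂, t, p₂, rfl⟩, rfl⟩
    refine ⟨![q₁, q₂, t, p₂], ?_⟩
    rw [vsub_eq_sub, eq_sub_iff_add_eq, dirMap_add_Q]
    simp
  · rintro ⟨c, rfl⟩
    refine ⟨_, ⟨c 0, c 1, c 2, c 3, rfl⟩, ?_⟩
    rw [vsub_eq_sub, eq_sub_iff_add_eq, dirMap_add_Q]
    simp only [add_zero]

/-- The quadratic form whose zeros are the characteristic covectors of the tableau. -/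
def charForm (a : ℝ) (ξ : Fin 2 → ℝ) : ℝ := Real.cos a * ξ 0 ^ 2 + Real.sin a * ξ 1 ^ 2

theorem sq_add_sq_ne_zero_of_charForm_ne_zero {a : ℝ} {ξ : Fin 2 → ℝ} (h : charForm a ξ ≠ 0) :
    ξ 0 ^ 2 + ξ 1 ^ 2 ≠ 0 := by
  intro h'
  have e0 : ξ 0 = 0 := by nlinarith [sq_nonneg (ξ 0), sq_nonneg (ξ 1)]
  have e1 : ξ 1 = 0 := by nlinarith [sq_nonneg (ξ 0), sq_nonneg (ξ 1)]
  exact h (by simp [charForm, e0, e1])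

theorem exists_charForm_ne_zero (a : ℝ) : ∃ ξ, charForm a ξ ≠ 0 := by
  by_cases h : Real.cos a = 0
  · refine ⟨![0, 1], ?_⟩
    have := Real.sin_sq_add_cos_sq a
    intro h'
    simp [charForm] at h'
    simp [h, h'] at this
  · exact ⟨![1, 0], by simpa [charForm] using h⟩

/-- The value at `ξ` of an element of the direction, in the coordinates `β¹, …, β⁴`. -/
def dirEval (a : ℝ) (ξ : Fin 2 → ℝ) : (Fin 4 → ℝ) →ₗ[ℝ] (Fin 4 → ℝ) where
  toFun c j := dirMat a c (Fin.castAdd 4 j) 0 * ξ 0 + dirMat a c (Fin.castAdd 4 j) 1 * ξ 1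
  map_add' c d := by
    ext j
    simp only [map_add, Pi.add_apply]
    ring
  map_smul' r c := by
    ext j
    simp only [map_smul, Pi.smul_apply, smul_eq_mul, RingHom.id_apply]
    ring

/-- Components `0` and `3` involve only `(q₁, q₂)`, with determinant `2 (ξ₀² + ξ₁²)` up to sign;
components `1` and `2` involve only `(t, p₂)`, with determinant `charForm a ξ` up to sign. The
linear combinations below are Cramer's rule in each block. -/
theorem dirEval_injective {a : ℝ} {ξ : Fin 2 → ℝ} (h : charForm a ξ ≠ 0) :
    Function.Injective (dirEval a ξ) := by
  rw [injective_iff_map_eq_zero]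
  intro c hc
  have e (j : Fin 4) : dirEval a ξ c j = 0 := by rw [hc]; rfl
  have h0 := e 0
  have h1 := e 1
  have h2 := e 2
  have h3 := e 3
  simp [dirEval, dirMat_apply, coordMat] at h0 h1 h2 h3
  have hξ := sq_add_sq_ne_zero_of_charForm_ne_zero h
  have c0 : c 0 = 0 := by
    refine (mul_eq_zero_iff_right hξ).mp ?_
    linear_combination ξ 0 * h3 + ξ 1 / 2 * h0
  have c1 : c 1 = 0 := by
    refine (mul_eq_zero_iff_right hξ).mp ?_
    linear_combination ξ 1 * h3 - ξ 0 / 2 * h0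
  have c2 : c 2 = 0 := by
    refine (mul_eq_zero_iff_right h).mp ?_
    rw [charForm]
    linear_combination ξ 0 * h1 + ξ 1 * h2
  have c3 : c 3 = 0 := by
    refine (mul_eq_zero_iff_right h).mp ?_
    rw [charForm]
    linear_combination -Real.cos a * ξ 0 * h2 + Real.sin a * ξ 1 * h1
  ext j
  fin_cases j <;> assumption

theorem dirEval_surjective {a : ℝ} {ξ : Fin 2 → ℝ} (h : charForm a ξ ≠ 0) :
    Function.Surjective (dirEval a ξ) :=
  LinearMap.injective_iff_surjective.mp (dirEval_injective h)

/-- The vector of `𝔞` with coordinates `ξ`. -/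
def vecA (ξ : Fin 2 → ℝ) : 𝔞 := ξ 0 • A 0 + ξ 1 • A 1

theorem αOn_vecA (ξ : Fin 2 → ℝ) (i : Fin 2) : αOn i (vecA ξ) = ξ i := by
  fin_cases i <;> simp [vecA]

theorem dirMap_eq_zero_of_apply {a : ℝ} {ξ : Fin 2 → ℝ} (h : charForm a ξ ≠ 0) {c : Fin 4 → ℝ}
    (hc : dirMap a c (vecA ξ) = 0) : c = 0 := by
  refine dirEval_injective h ?_
  rw [map_zero]
  ext j
  have := coordB_dirMap a c (vecA ξ) (Fin.castAdd 4 j)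
  rw [hc, map_zero, αOn_vecA, αOn_vecA] at this
  exact this.symm

theorem dirMap_injective (a : ℝ) : Function.Injective (dirMap a) := by
  obtain ⟨ξ, hξ⟩ := exists_charForm_ne_zero a
  rw [injective_iff_map_eq_zero]
  intro c hc
  exact dirMap_eq_zero_of_apply hξ (by rw [hc]; rfl)

theorem dirMat_injective (a : ℝ) : Function.Injective (dirMat a) := by
  obtain ⟨ξ, hξ⟩ := exists_charForm_ne_zero a
  rw [injective_iff_map_eq_zero]
  intro c hc
  refine dirEval_injective hξ ?_
  rw [map_zero]
  ext j
  simp [dirEval, hc]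

theorem finrank_range_dirMap (a : ℝ) :
    Module.finrank ℝ (LinearMap.range (dirMap a)) = 4 := by
  rw [LinearMap.finrank_range_of_inj (dirMap_injective a), Module.finrank_fin_fun]

/-! ### Characters and prolongation -/

theorem finrank_kerOn_eq_zero {a : ℝ} {ξ : Fin 2 → ℝ} (h : charForm a ξ ≠ 0)
    {S : Submodule ℝ 𝔞} (hS : vecA ξ ∈ S) :
    Module.finrank ℝ (Tableau.kerOn (LinearMap.range (dirMap a)) S) = 0 := by
  have : Tableau.kerOn (LinearMap.range (dirMap a)) S = ⊥ := by
    rw [eq_bot_iff]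
    rintro _ ⟨⟨c, rfl⟩, hc⟩
    rw [dirMap_eq_zero_of_apply h (hc _ hS), map_zero]
    exact zero_mem _
  rw [this, finrank_bot]

theorem genericKerDim_zero (a : ℝ) :
    Tableau.genericKerDim (LinearMap.range (dirMap a)) 0 = 4 := by
  have : {d | ∃ S : Submodule ℝ 𝔞, Module.finrank ℝ S = 0 ∧
      Module.finrank ℝ (Tableau.kerOn (LinearMap.range (dirMap a)) S) = d} = {4} := by
    have e : Tableau.kerOn (LinearMap.range (dirMap a)) ⊥ = LinearMap.range (dirMap a) := by
      ext R
      refine ⟨fun h => h.1, fun h => ⟨h, fun u hu => ?_⟩⟩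
      rw [(Submodule.mem_bot ℝ).mp hu, map_zero]
    have e' := finrank_range_dirMap a
    ext d
    constructor
    · rintro ⟨S, hS, rfl⟩
      rw [Submodule.finrank_eq_zero.mp hS, e, e']
      rfl
    · rintro rfl
      exact ⟨⊥, finrank_bot ℝ 𝔞, by rw [e, e']⟩
  rw [Tableau.genericKerDim, this, csInf_singleton]

/-- Zero is the least conceivable dimension, so exhibiting one noncharacteristic line is enough to
compute the minimum. -/
theorem genericKerDim_one (a : ℝ) :
    Tableau.genericKerDim (LinearMap.range (dirMap a)) 1 = 0 := by
  obtain ⟨ξ, hξ⟩ := exists_charForm_ne_zero a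
  refine Nat.sInf_eq_zero.mpr (.inl ⟨Submodule.span ℝ {vecA ξ}, finrank_span_singleton ?_,
    finrank_kerOn_eq_zero hξ (Submodule.mem_span_singleton_self _)⟩)
  intro h
  have h' (i : Fin 2) : ξ i = 0 := by rw [← αOn_vecA ξ i, h, map_zero]
  exact hξ (by simp [charForm, h'])

theorem genericKerDim_two (a : ℝ) :
    Tableau.genericKerDim (LinearMap.range (dirMap a)) 2 = 0 := by
  obtain ⟨ξ, hξ⟩ := exists_charForm_ne_zero a
  exact Nat.sInf_eq_zero.mpr (.inl ⟨⊤, by rw [finrank_top, finrank_𝔞],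
    finrank_kerOn_eq_zero hξ Submodule.mem_top⟩)

theorem character_one (a : ℝ) : Tableau.character (LinearMap.range (dirMap a)) 1 = 4 := by
  rw [Tableau.character, genericKerDim_zero, genericKerDim_one]

theorem character_two (a : ℝ) : Tableau.character (LinearMap.range (dirMap a)) 2 = 0 := by
  rw [Tableau.character, genericKerDim_one, genericKerDim_two]

/-- The element of `Hom(𝔞, M)` that maps `A₁, A₂` to given elements. -/
def homMk (a : ℝ) :
    (Fin 4 → ℝ) × (Fin 4 → ℝ) →ₗ[ℝ] (𝔞 →ₗ[ℝ] LinearMap.range (dirMap a)) where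
  toFun c := (αOn 0).smulRight ((dirMap a).rangeRestrict c.1) +
    (αOn 1).smulRight ((dirMap a).rangeRestrict c.2)
  map_add' c d := by
    ext1 x
    simp only [Prod.fst_add, Prod.snd_add, map_add, LinearMap.add_apply,
      LinearMap.smulRight_apply]
    module
  map_smul' r c := by
    ext1 x
    simp only [Prod.smul_fst, Prod.smul_snd, map_smul, LinearMap.add_apply,
      LinearMap.smulRight_apply, LinearMap.smul_apply, RingHom.id_apply]
    module

theorem homMk_apply (a : ℝ) (c : (Fin 4 → ℝ) × (Fin 4 → ℝ)) (x : 𝔞) :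
    (homMk a c x : 𝔞 →ₗ[ℝ] 𝔟) = αOn 0 x • dirMap a c.1 + αOn 1 x • dirMap a c.2 := rfl

theorem homMk_injective (a : ℝ) : Function.Injective (homMk a) := by
  rw [injective_iff_map_eq_zero]
  intro c hc
  have h0 := homMk_apply a c (A 0)
  have h1 := homMk_apply a c (A 1)
  simp [hc] at h0 h1
  exact Prod.ext (dirMap_injective a (by rw [← h0, Prod.fst_zero, map_zero]))
    (dirMap_injective a (by rw [← h1, Prod.snd_zero, map_zero]))

theorem homMk_surjective (a : ℝ) : Function.Surjective (homMk a) := by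
  intro F
  obtain ⟨c, hc⟩ := (F (A 0)).2
  obtain ⟨d, hd⟩ := (F (A 1)).2
  refine ⟨(c, d), LinearMap.ext fun x => Subtype.ext ?_⟩
  rw [homMk_apply, hc, hd]
  conv_rhs => rw [eq_A_add_A x]
  simp

/-- The components of the difference `F(A₁)(A₂) - F(A₂)(A₁)`. -/
def skew (a : ℝ) (c : (Fin 4 → ℝ) × (Fin 4 → ℝ)) (j : Fin 8) : ℝ :=
  dirMat a c.1 j 1 - dirMat a c.2 j 0

theorem coordB_spencer (a : ℝ) (c : (Fin 4 → ℝ) × (Fin 4 → ℝ)) (x y : 𝔞) (j : Fin 8) :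
    coordB (Tableau.spencer (LinearMap.range (dirMap a)) (homMk a c) x y) j =
      1 / 2 * (αOn 0 x * αOn 1 y - αOn 1 x * αOn 0 y) * skew a c j := by
  have : Tableau.spencer (LinearMap.range (dirMap a)) (homMk a c) x y =
      (1 / 2 : ℝ) • ((homMk a c x : 𝔞 →ₗ[ℝ] 𝔟) y - (homMk a c y : 𝔞 →ₗ[ℝ] 𝔟) x) := rfl
  rw [this, homMk_apply, homMk_apply]
  simp only [map_smul, map_sub, map_add, LinearMap.add_apply, LinearMap.smul_apply,
    Pi.smul_apply, Pi.sub_apply, Pi.add_apply, coordB_dirMap, smul_eq_mul, skew]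
  ring

theorem homMk_mem_prolongation_iff (a : ℝ) (c : (Fin 4 → ℝ) × (Fin 4 → ℝ)) :
    homMk a c ∈ Tableau.prolongation (LinearMap.range (dirMap a)) ↔ ∀ j, skew a c j = 0 := by
  rw [Tableau.prolongation, LinearMap.mem_ker]
  constructor
  · intro h j
    have := coordB_spencer a c (A 0) (A 1) j
    rw [h] at this
    simpa using this
  · intro h
    ext1 x
    ext1 y
    refine coordB_injective (funext fun j => ?_)
    rw [coordB_spencer, h]
    simp

/-- The parametrization of the first prolongation. -/
def prolongMap (a : ℝ) : (Fin 4 → ℝ) →ₗ[ℝ] (Fin 4 → ℝ) × (Fin 4 → ℝ) where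
  -- With primes marking the second element, `skew = 0` reads `q₂' = -q₁`, `q₁' = q₂`, `p₂ = t' cos
  -- a`, `p₂' = -t sin a`. The free parameters are `q₁, q₂, t, t'`.
  toFun d := (![d 0, d 1, d 2, d 3 * Real.cos a], ![d 1, -d 0, d 3, -(d 2 * Real.sin a)])
  map_add' c d := by
    ext j <;> fin_cases j <;> simp <;> ring
  map_smul' r d := by
    ext j <;> fin_cases j <;> simp <;> ring

theorem prolongMap_injective (a : ℝ) : Function.Injective (prolongMap a) := by
  rw [injective_iff_map_eq_zero]
  intro d hd
  have h1 := congrArg Prod.fst hd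
  have h2 := congrArg Prod.snd hd
  ext j
  fin_cases j
  · exact congrFun h1 0
  · exact congrFun h1 1
  · exact congrFun h1 2
  · exact congrFun h2 2

theorem skew_eq_zero_iff (a : ℝ) (c : (Fin 4 → ℝ) × (Fin 4 → ℝ)) :
    (∀ j, skew a c j = 0) ↔ ∃ d, prolongMap a d = c := by
  constructor
  · intro h
    have h0 := h 0
    have h1 := h 1
    have h2 := h 2
    have h3 := h 3
    simp [skew, dirMat_apply, coordMat] at h0 h1 h2 h3
    refine ⟨![c.1 0, c.1 1, c.1 2, c.2 2], ?_⟩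
    ext j <;> fin_cases j <;> simp [prolongMap] <;> linarith
  · rintro ⟨d, rfl⟩ j
    fin_cases j <;> simp [skew, dirMat_apply, coordMat, prolongMap]

theorem _root_.Submodule.finrank_eq_of_forall_mem_iff {V : Type*} [AddCommMonoid V] [Module ℝ V]
    {n : ℕ} (p : Submodule ℝ V) (f : (Fin n → ℝ) →ₗ[ℝ] V) (hf : Function.Injective f)
    (h : ∀ v, v ∈ p ↔ ∃ d, f d = v) : Module.finrank ℝ p = n := by
  have : p = LinearMap.range f := by
    ext v
    exact h v
  rw [this, ← (LinearEquiv.ofInjective f hf).finrank_eq, Module.finrank_fin_fun]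

theorem _root_.Tableau.finrank_prolongation_eq {U V : Type*} [AddCommGroup U] [Module ℝ U]
    [AddCommGroup V] [Module ℝ V] (D : Submodule ℝ (U →ₗ[ℝ] V)) {n : ℕ}
    (f : (Fin n → ℝ) →ₗ[ℝ] (U →ₗ[ℝ] D)) (hf : Function.Injective f)
    (h : ∀ F, F ∈ Tableau.prolongation D ↔ ∃ d, f d = F) :
    Module.finrank ℝ (Tableau.prolongation D) = n :=
  Submodule.finrank_eq_of_forall_mem_iff _ f hf h

theorem finrank_prolongation (a : ℝ) :
    Module.finrank ℝ (Tableau.prolongation (LinearMap.range (dirMap a))) = 4 := by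
  refine Tableau.finrank_prolongation_eq _ (homMk a ∘ₗ prolongMap a)
    ((homMk_injective a).comp (prolongMap_injective a)) fun F => ?_
  obtain ⟨c, rfl⟩ := homMk_surjective a F
  refine (homMk_mem_prolongation_iff a c).trans ((skew_eq_zero_iff a c).trans ?_)
  exact exists_congr fun d => (homMk_injective a).eq_iff.symm

theorem isInvolutiveAffine (a b₁ b₂ : ℝ) :
    Tableau.IsInvolutiveAffine (affineTableau a b₁ b₂) := by
  refine ⟨⟨_, 0, 0, 0, 0, rfl⟩, ?_⟩
  rw [direction_affineTableau, Tableau.IsInvolutive, finrank_prolongation, finrank_𝔞]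
  -- `4 = 1 * 4 + 2 * 0`.
  simp [Finset.sum_Icc_succ_top, character_one, character_two]

/-! ### The torsion condition -/

theorem coe_add_eq_graphElt {R : 𝔞 →ₗ[ℝ] 𝔟} {M : Fin 8 → Fin 2 → ℝ}
    (h : ∀ x j, coordB (R x) j = M j 0 * αOn 0 x + M j 1 * αOn 1 x) (x : 𝔞) :
    (((x : lieAlg) + (R x : lieAlg) : lieAlg) : Mat) = graphElt M fun i => αOn i x := by
  refine ext_coords (SetLike.coe_mem _) (ofCoords_mem _ _) (fun i => ?_) fun j => ?_
  · rw [graphElt, α_ofCoords, AddMemClass.coe_add, map_add, α_of_mem_𝔟 i (R x).2, add_zero,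
      αOn_apply]
  · rw [graphElt, βγ_ofCoords, AddMemClass.coe_add, map_add, βγ_of_mem_𝔞 j x.2, zero_add,
      ← coordB_apply, h]

/-- Since `x + R x` is the graph element over `x`, the definition of `τ` is that of `torsion`, with
the two projections read off as the coordinates `α` and `(β, γ)` of the bracket. -/
theorem coordB_tau {R : 𝔞 →ₗ[ℝ] 𝔟} {M : Fin 8 → Fin 2 → ℝ}
    (h : ∀ x j, coordB (R x) j = M j 0 * αOn 0 x + M j 1 * αOn 1 x) (x y : 𝔞) (j : Fin 8) :
    coordB (Tableau.tau isCompl R x y) j =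
      (αOn 0 x * αOn 1 y - αOn 1 x * αOn 0 y) * graphTorsion M j := by
  rw [← torsion_graphElt M (fun i => αOn i x) (fun i => αOn i y) j, ← coe_add_eq_graphElt h,
    ← coe_add_eq_graphElt h, Tableau.tau, map_sub, Pi.sub_apply, h]
  set X : lieAlg := (x : lieAlg) + (R x : lieAlg)
  set Y : lieAlg := (y : lieAlg) + (R y : lieAlg)
  have hb : (X : Mat) * Y - Y * X = ((⁅X, Y⁆ : lieAlg) : Mat) := rfl
  have hs : ((⁅X, Y⁆ : lieAlg) : Mat) =
      ((𝔞.projectionOnto 𝔟 isCompl ⁅X, Y⁆ : lieAlg) : Mat) +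
        ((𝔟.projectionOnto 𝔞 isCompl.symm ⁅X, Y⁆ : lieAlg) : Mat) := by
    rw [← AddMemClass.coe_add]
    congr 1
    simpa using (Submodule.projection_add_projection_eq_self isCompl ⁅X, Y⁆).symm
  have hα (i : Fin 2) : αOn i (𝔞.projectionOnto 𝔟 isCompl ⁅X, Y⁆) = α i (⁅X, Y⁆ : lieAlg) := by
    rw [hs, map_add, α_of_mem_𝔟 i (SetLike.coe_mem _), add_zero, αOn_apply]
  have hβ : coordB (𝔟.projectionOnto 𝔞 isCompl.symm ⁅X, Y⁆) j = βγ j (⁅X, Y⁆ : lieAlg) := by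
    rw [hs, map_add, βγ_of_mem_𝔞 j (SetLike.coe_mem _), zero_add, coordB_apply]
  rw [torsion, hb, hα, hα, hβ, Fin.sum_univ_two]

theorem exists_skew_eq (a : ℝ) {T : Fin 8 → ℝ} (hT : ∀ j : Fin 4, T (Fin.natAdd 4 j) = 0) :
    ∃ c, ∀ j, skew a c j = T j := by
  -- The four equations are `2 q₁ + 2 q₂' = T 0`, `p₂ - t' cos a = T 1`, `t sin a + p₂' = T 2`, `q₂
  -- - q₁' = T 3`. Taking `t = t' = 0` removes the dependence on `a`, and each equation is then
  -- solved by a parameter of its own.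
  refine ⟨(![T 0 / 2, 0, 0, T 1], ![-T 3, 0, 0, T 2]), fun j => ?_⟩
  have h0 := hT 0
  have h1 := hT 1
  have h2 := hT 2
  have h3 := hT 3
  simp at h0 h1 h2 h3
  fin_cases j <;> simp [skew, dirMat_apply, coordMat, *]
  ring

theorem isAffineTableauOver (a b₁ b₂ : ℝ) :
    Tableau.IsAffineTableauOver isCompl (affineTableau a b₁ b₂) := by
  refine ⟨isInvolutiveAffine a b₁ b₂, ?_⟩
  -- The type of `F` depends on the direction, so the direction is generalized before being replaced
  -- by `range (dirMap a)`.
  suffices h : ∀ D : Submodule ℝ (𝔞 →ₗ[ℝ] 𝔟), D = LinearMap.range (dirMap a) →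
      ∀ R ∈ affineTableau a b₁ b₂, ∃ F : 𝔞 →ₗ[ℝ] D, ∀ x y : 𝔞,
        Tableau.tau isCompl R x y = Tableau.spencer D F x y from
    h _ (direction_affineTableau a b₁ b₂)
  rintro _ rfl _ ⟨q₁, q₂, t, p₂, rfl⟩
  set M := coordMat q₁ q₂ (t * Real.cos a + b₁) p₂ (t * Real.sin a + b₂)
  -- The factor `2` cancels the `1 / 2` in the Spencer coboundary.
  obtain ⟨c, hc⟩ := exists_skew_eq a (T := fun j => 2 * graphTorsion M j) fun j => by
    simp only [M, graphTorsion_coordMat, mul_zero]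
  refine ⟨homMk a c, fun x y => coordB_injective (funext fun j => ?_)⟩
  rw [coordB_spencer, hc, coordB_tau (coordB_Q _ _ _ _ _)]
  ring

end Moebius

/-! ### Tangent spaces of embedded submanifolds -/

section Tangent

variable {W F : Type*} [NormedAddCommGroup W] [NormedSpace ℝ W] [NormedAddCommGroup F]
  [NormedSpace ℝ F]

theorem hasDerivAt_add_smul (z w : W) : HasDerivAt (fun t : ℝ => z + t • w) w 0 := by
  simpa using ((hasDerivAt_id (0 : ℝ)).smul_const w).const_add z

theorem mem_embTangent_of_hasDerivAt {Z : Set W} {γ : ℝ → W} {v : W} (hγ : HasDerivAt γ v 0)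
    (hZ : ∀ᶠ t in 𝓝 0, γ t ∈ Z) : v ∈ embTangent Z (γ 0) := by
  refine Submodule.subset_span ?_
  have h := hγ.hasFDerivAt.hasFDerivWithinAt (s := {t | γ t ∈ Z}) |>.mapsTo_tangent_cone
  have h1 : (1 : ℝ) ∈ tangentConeAt ℝ {t | γ t ∈ Z} 0 := by
    rw [tangentConeAt_of_mem_nhds hZ]
    trivial
  have h2 := h h1
  rw [ContinuousLinearMap.toSpanSingleton_apply, one_smul] at h2
  refine tangentConeAt_mono ?_ h2
  rintro _ ⟨t, ht, rfl⟩
  exact ht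

theorem apply_eq_zero_of_mem_embTangent {Z : Set W} {z v : W} {f : W → F} {f' : W →L[ℝ] F}
    (hf : HasFDerivAt f f' z) (hz : z ∈ Z) {c : F} (hc : ∀ x ∈ Z, f x = c) (hv : v ∈ embTangent Z z) :
    f' v = 0 := by
  suffices h : embTangent Z z ≤ LinearMap.ker f'.toLinearMap from h hv
  rw [embTangent, Submodule.span_le]
  intro w hw
  have h := hf.hasFDerivWithinAt.mapsTo_tangent_cone hw
  -- `f'` maps the tangent cone of `Z` into that of `f '' Z`. This image is a single point, which is
  -- not an accumulation point, so its tangent cone is contained in `0`.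
  refine tangentConeAt_subset_zero (fun hacc => ?_) h
  obtain ⟨_, hne, x, hx, rfl⟩ := (accPt_iff_frequently.mp hacc).exists
  exact hne ((hc x hx).trans (hc z hz).symm)

end Tangent

theorem linearIndependent_of_dual {ι V : Type*} [AddCommGroup V] [Module ℝ V]
    {f : ι → V →ₗ[ℝ] ℝ} [DecidableEq ι] (w : ι → V)
    (h : ∀ i j, f i (w j) = if i = j then 1 else 0) : LinearIndependent ℝ f := by
  rw [linearIndependent_iff']
  intro s c hc i hi
  have := LinearMap.congr_fun hc (w i)
  simpa [h, hi] using this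

namespace Moebius

attribute [local instance 100] LieRing.ofAssociativeRing

/-! ### The group -/

theorem isUnit_gram : IsUnit gram := by
  have h : gram * !![0, 0, 0, 0, -2; 0, 1, 0, 0, 0; 0, 0, 1, 0, 0; 0, 0, 0, 1, 0;
      -2, 0, 0, 0, 0] = 1 := by
    ext i j
    fin_cases i <;> fin_cases j <;> simp [gram, Matrix.mul_apply, Fin.sum_univ_succ]
  exact IsUnit.of_mul_eq_one _ h

theorem gram_of_mem_group {g : Mat} (hg : g ∈ group) : gᵀ * gram * g = gram :=
  connectedComponentIn_subset {g : Mat | gᵀ * gram * g = gram} 1 hg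

theorem isUnit_of_mem_group {g : Mat} (hg : g ∈ group) : IsUnit g := by
  have h := (Matrix.isUnit_iff_isUnit_det _).mp isUnit_gram
  rw [← gram_of_mem_group hg, Matrix.det_mul] at h
  exact (Matrix.isUnit_iff_isUnit_det g).mpr (isUnit_of_mul_isUnit_right h)

theorem isUnit_det_of_mem_group {g : Mat} (hg : g ∈ group) : IsUnit g.det :=
  (Matrix.isUnit_iff_isUnit_det g).mp (isUnit_of_mem_group hg)

section Exp

attribute [local instance] Matrix.linftyOpNormedRing Matrix.linftyOpNormedAlgebra

theorem hasFDerivAt_inv {y : Ambient} (hy : IsUnit y.1) :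
    HasFDerivAt (fun z : Ambient => z.1⁻¹)
      (-(ContinuousLinearMap.mulLeftRight ℝ Mat y.1⁻¹ y.1⁻¹) ∘L
        ContinuousLinearMap.fst ℝ Mat (Fin 8 → Fin 2 → ℝ)) y := by
  obtain ⟨u, hu⟩ := hy
  have h := hasFDerivAt_ringInverse (𝕜 := ℝ) u
  have e : (fun z : Ambient => z.1⁻¹) = Ring.inverse ∘ Prod.fst := by
    funext z
    exact Matrix.nonsing_inv_eq_ringInverse z.1
  rw [e, ← hu, ← Matrix.coe_units_inv]
  rw [hu] at h
  exact h.comp y hasFDerivAt_fst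

/-- The derivative of `ω`-components `ℓ (g⁻¹ V)` with respect to `g`. -/
theorem hasFDerivAt_apply_inv_mul {y : Ambient} (hy : IsUnit y.1) (ℓ : Mat →ₗ[ℝ] ℝ) (V : Mat) :
    ∃ f' : Ambient →L[ℝ] ℝ, HasFDerivAt (fun z : Ambient => ℓ (z.1⁻¹ * V)) f' y ∧
      ∀ u, f' u = -ℓ (y.1⁻¹ * u.1 * (y.1⁻¹ * V)) := by
  let m : Mat →L[ℝ] ℝ := LinearMap.toContinuousLinearMap (ℓ ∘ₗ LinearMap.mulRight ℝ V)
  refine ⟨_, m.hasFDerivAt.comp y (hasFDerivAt_inv hy), fun u => ?_⟩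
  change ℓ (-(y.1⁻¹ * u.1 * y.1⁻¹) * V) = _
  rw [neg_mul, map_neg, mul_assoc (y.1⁻¹ * u.1)]

theorem continuous_exp_smul (X : Mat) : Continuous fun t : ℝ => NormedSpace.exp (t • X) :=
  continuous_iff_continuousAt.mpr fun t =>
    (hasDerivAt_exp_smul_const (𝕂 := ℝ) X t).continuousAt

theorem hasDerivAt_mul_exp (g X : Mat) :
    HasDerivAt (fun t : ℝ => g * NormedSpace.exp (t • X)) (g * X) 0 := by
  have h := (hasDerivAt_exp_smul_const (𝕂 := ℝ) X 0).const_mul g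
  rw [zero_smul, NormedSpace.exp_zero, one_mul] at h
  exact h

theorem hasFDerivAt_gram (y : Ambient) :
    ∃ f' : Ambient →L[ℝ] Mat, HasFDerivAt (fun z : Ambient => z.1ᵀ * gram * z.1) f' y ∧
      ∀ u, f' u = y.1ᵀ * gram * u.1 + u.1ᵀ * gram * y.1 := by
  let m : Mat →L[ℝ] Mat := LinearMap.toContinuousLinearMap
    (LinearMap.mulRight ℝ gram ∘ₗ (Matrix.transposeLinearEquiv (Fin 5) (Fin 5) ℝ ℝ).toLinearMap)
  have h1 := m.hasFDerivAt.comp y (hasFDerivAt_fst (𝕜 := ℝ) (E := Mat) (F := Fin 8 → Fin 2 → ℝ))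
  have h2 := h1.mul' (hasFDerivAt_fst (𝕜 := ℝ) (E := Mat) (F := Fin 8 → Fin 2 → ℝ))
  exact ⟨_, h2, fun u => rfl⟩

end Exp

/-- Membership in `𝔤` says that `Xᵀ` is the conjugate of `-X` by the Gram matrix, and `exp` commutes
with transposition and conjugation. -/
theorem gram_exp {X : Mat} (hX : X ∈ lieAlg) :
    (NormedSpace.exp X)ᵀ * gram * NormedSpace.exp X = gram := by
  have hdet : IsUnit gram.det := (Matrix.isUnit_iff_isUnit_det _).mp isUnit_gram
  have hXT : Xᵀ = gram * -X * gram⁻¹ := by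
    rw [← (mem_lieAlg_iff X).mp hX, Matrix.mul_nonsing_inv_cancel_right _ _ hdet]
  have hexp : IsUnit (NormedSpace.exp X).det :=
    (Matrix.isUnit_iff_isUnit_det _).mp (Matrix.isUnit_exp X)
  rw [← Matrix.exp_transpose, hXT, Matrix.exp_conj _ _ isUnit_gram, Matrix.exp_neg,
    Matrix.nonsing_inv_mul_cancel_right _ _ hdet, Matrix.nonsing_inv_mul_cancel_right _ _ hexp]

/-- The curve `t ↦ g exp(tX)` is connected, passes through `g` and preserves the form, so it cannot
leave the component of `g`. -/
theorem mul_exp_mem_group {g X : Mat} (hg : g ∈ group) (hX : X ∈ lieAlg) (t : ℝ) :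
    g * NormedSpace.exp (t • X) ∈ group := by
  have hsub : Set.range (fun t : ℝ => g * NormedSpace.exp (t • X)) ⊆
      {g : Mat | gᵀ * gram * g = gram} := by
    rintro _ ⟨s, rfl⟩
    have h := gram_exp (lieAlg.toSubmodule.smul_mem s hX)
    have hg' := gram_of_mem_group hg
    change (g * NormedSpace.exp (s • X))ᵀ * gram * (g * NormedSpace.exp (s • X)) = gram
    calc (g * NormedSpace.exp (s • X))ᵀ * gram * (g * NormedSpace.exp (s • X))
        = (NormedSpace.exp (s • X))ᵀ * (gᵀ * gram * g) * NormedSpace.exp (s • X) := by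
          rw [Matrix.transpose_mul]
          simp only [mul_assoc]
      _ = gram := by rw [hg', h]
  have hconn : IsPreconnected (Set.range fun t : ℝ => g * NormedSpace.exp (t • X)) :=
    isPreconnected_range ((continuous_const (y := g)).matrix_mul (continuous_exp_smul X))
  have h0 : g ∈ Set.range fun t : ℝ => g * NormedSpace.exp (t • X) :=
    ⟨0, by simp⟩
  rw [group, connectedComponentIn_eq hg]
  exact hconn.subset_connectedComponentIn h0 hsub ⟨t, rfl⟩

/-! ### The manifold `Y` and its tangent spaces -/

theorem mem_carrier_iff {a b₁ b₂ : ℝ} {y : Ambient} :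
    y ∈ (system (affineTableau a b₁ b₂)).carrier ↔ y.1 ∈ group ∧ ∃ q₁ q₂ t p₂ : ℝ,
      y.2 = coordMat q₁ q₂ (t * Real.cos a + b₁) p₂ (t * Real.sin a + b₂) := by
  refine and_congr_right fun _ => ⟨?_, ?_⟩
  · rintro ⟨_, ⟨q₁, q₂, t, p₂, rfl⟩, h⟩
    refine ⟨q₁, q₂, t, p₂, ?_⟩
    ext j i
    rw [h, βγ_Q_A]
  · rintro ⟨q₁, q₂, t, p₂, h⟩
    exact ⟨_, ⟨q₁, q₂, t, p₂, rfl⟩, fun j i => by rw [h, βγ_Q_A]⟩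

theorem coordMat_add_dirMat (a b₁ b₂ : ℝ) (c : Fin 4 → ℝ) (q₁ q₂ t p₂ : ℝ) :
    coordMat q₁ q₂ (t * Real.cos a + b₁) p₂ (t * Real.sin a + b₂) + dirMat a c =
      coordMat (q₁ + c 0) (q₂ + c 1) ((t + c 2) * Real.cos a + b₁) (p₂ + c 3)
        ((t + c 2) * Real.sin a + b₂) := by
  ext j i
  fin_cases j <;> fin_cases i <;> simp [dirMat_apply, coordMat] <;> ring

section System

variable {a b₁ b₂ : ℝ} {y : Ambient}

theorem add_dirMat_of_mem_carrier (hy : y ∈ (system (affineTableau a b₁ b₂)).carrier)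
    (c : Fin 4 → ℝ) : ∃ q₁ q₂ t p₂ : ℝ,
      y.2 + dirMat a c = coordMat q₁ q₂ (t * Real.cos a + b₁) p₂ (t * Real.sin a + b₂) := by
  obtain ⟨-, q₁, q₂, t, p₂, h⟩ := mem_carrier_iff.mp hy
  exact ⟨_, _, _, _, h ▸ coordMat_add_dirMat a b₁ b₂ c q₁ q₂ t p₂⟩

/-- Tangent vectors satisfy these conditions because the functions defining `Y` are constant on it.
Conversely, such a vector is the velocity of `t ↦ (g exp(tX), M + t N)`, which stays in `Y`. -/
theorem mem_tangent_iff (hy : y ∈ (system (affineTableau a b₁ b₂)).carrier) {v : Ambient} :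
    v ∈ (system (affineTableau a b₁ b₂)).tangent y ↔
      y.1⁻¹ * v.1 ∈ lieAlg ∧ ∃ c, v.2 = dirMat a c := by
  have hg := (mem_carrier_iff.mp hy).1
  have hdet := isUnit_det_of_mem_group hg
  constructor
  · intro hv
    constructor
    · obtain ⟨f', hf, hf'⟩ := hasFDerivAt_gram y
      have h := apply_eq_zero_of_mem_embTangent hf hy (fun x hx => gram_of_mem_group hx.1) hv
      replace h := (hf' v).symm.trans h
      obtain ⟨X, hX⟩ : ∃ X, v.1 = y.1 * X :=
        ⟨y.1⁻¹ * v.1, by rw [Matrix.mul_nonsing_inv_cancel_left _ _ hdet]⟩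
      rw [hX, Matrix.nonsing_inv_mul_cancel_left _ _ hdet, mem_lieAlg_iff, mul_neg,
        eq_neg_iff_add_eq_zero, ← h, hX, Matrix.transpose_mul]
      calc Xᵀ * gram + gram * X = Xᵀ * (y.1ᵀ * gram * y.1) + (y.1ᵀ * gram * y.1) * X := by
            rw [gram_of_mem_group hg]
        _ = _ := by
            simp only [mul_assoc]
            rw [add_comm]
    -- Otherwise some linear functional kills the direction but not `v.2`; it is constant on the
    -- affine fibre, hence must kill every tangent vector.
    · by_contra hc
      have hn : v.2 ∉ LinearMap.range (dirMat a) := fun ⟨c, h⟩ => hc ⟨c, h.symm⟩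
      obtain ⟨f, hfv, hf⟩ := Submodule.exists_le_ker_of_notMem hn
      let f' : Ambient →L[ℝ] ℝ :=
        LinearMap.toContinuousLinearMap (f ∘ₗ LinearMap.snd ℝ Mat (Fin 8 → Fin 2 → ℝ))
      refine hfv (apply_eq_zero_of_mem_embTangent (f'.hasFDerivAt (x := y)) hy (c := f y.2)
        (fun x hx => ?_) hv)
      obtain ⟨-, q₁, q₂, t, p₂, hx⟩ := mem_carrier_iff.mp hx
      obtain ⟨-, q₁', q₂', t', p₂', hy⟩ := mem_carrier_iff.mp hy
      have e := coordMat_add_dirMat a b₁ b₂ ![q₁ - q₁', q₂ - q₂', t - t', p₂ - p₂'] q₁' q₂' t' p₂'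
      simp only [Matrix.cons_val, add_sub_cancel] at e
      change f x.2 = f y.2
      rw [hx, hy, ← e, map_add, hf ⟨_, rfl⟩, add_zero]
  · rintro ⟨hX, c, hc⟩
    have h1 := hasDerivAt_mul_exp y.1 (y.1⁻¹ * v.1)
    rw [Matrix.mul_nonsing_inv_cancel_left _ _ hdet] at h1
    have h := mem_embTangent_of_hasDerivAt (Z := (system (affineTableau a b₁ b₂)).carrier)
      (h1.prodMk (hasDerivAt_add_smul y.2 v.2)) (.of_forall fun t => ?_)
    · rw [zero_smul, zero_smul, NormedSpace.exp_zero, mul_one, add_zero] at h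
      exact h
    · refine mem_carrier_iff.mpr ⟨mul_exp_mem_group hg hX t, ?_⟩
      rw [hc, ← map_smul]
      exact add_dirMat_of_mem_carrier hy _

end System

end Moebius

/-! ### Exterior derivatives of the generators -/

theorem differentiableAt_clm_of_apply {D E F : Type*} [NormedAddCommGroup D] [NormedSpace ℝ D]
    [NormedAddCommGroup E] [NormedSpace ℝ E] [NormedAddCommGroup F] [NormedSpace ℝ F]
    [FiniteDimensional ℝ E] {f : D → E →L[ℝ] F} {x : D}
    (h : ∀ e, DifferentiableAt ℝ (fun x => f x e) x) : DifferentiableAt ℝ f x := by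
  let d := Module.finrank ℝ E
  have hd : d = Module.finrank ℝ (Fin d → ℝ) := (Module.finrank_fin_fun ℝ).symm
  let e₁ := ContinuousLinearEquiv.ofFinrankEq hd
  let e₂ := (e₁.arrowCongr (1 : F ≃L[ℝ] F)).trans (ContinuousLinearEquiv.piRing (Fin d))
  rw [← Function.id_comp f, ← e₂.symm_comp_self]
  exact e₂.symm.differentiableAt.comp x (differentiableAt_pi.mpr fun i => h _)

namespace PfaffianSystem

variable {W : Type*} [NormedAddCommGroup W] [NormedSpace ℝ W] {s n : ℕ}

theorem dθ_eq (S : PfaffianSystem W s n) {a : Fin s} {y : W} (h : DifferentiableAt ℝ (S.θ a) y)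
    (u v : W) :
    S.dθ a y u v = fderiv ℝ (fun z => S.θ a z v) y u - fderiv ℝ (fun z => S.θ a z u) y v := by
  have h' : DifferentiableAt ℝ
      (fun z => ContinuousAlternatingMap.ofSubsingleton ℝ W ℝ (0 : Fin 1) (S.θ a z)) y :=
    (ContinuousAlternatingMap.ofSubsingletonLIE (𝕜 := ℝ) (E := W) (F := ℝ) (ι := Fin 1)
      (i := 0)).differentiableAt.comp y h
  rw [dθ, extDeriv_apply h', Fin.sum_univ_two]
  simp [Fin.removeNth, sub_eq_add_neg]

theorem dθ_self (S : PfaffianSystem W s n) {a : Fin s} {y : W} (u : W) : S.dθ a y u u = 0 :=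
  (extDeriv _ y).map_eq_zero_of_eq _ (i := 0) (j := 1) rfl (by decide)

end PfaffianSystem

namespace Moebius

attribute [local instance 100] LieRing.ofAssociativeRing

variable {𝔸 : AffineSubspace ℝ (𝔞 →ₗ[ℝ] 𝔟)} {y : Ambient}

theorem ω_apply (i : Fin 2) (v : Ambient) : (system 𝔸).ω i y v = α i (y.1⁻¹ * v.1) := rfl

theorem θ_apply (j : Fin 8) (v : Ambient) :
    (system 𝔸).θ j y v = βγ j (y.1⁻¹ * v.1) - ∑ i, y.2 j i * α i (y.1⁻¹ * v.1) := by
  change ((βγ j - ∑ i, y.2 j i • α i) ∘ₗ mc y) v = _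
  simp [mc]

theorem hasFDerivAt_θ_apply (hy : IsUnit y.1) (j : Fin 8) (v : Ambient) :
    ∃ f' : Ambient →L[ℝ] ℝ, HasFDerivAt (fun z => (system 𝔸).θ j z v) f' y ∧
      ∀ u : Ambient, f' u = -βγ j (y.1⁻¹ * u.1 * (y.1⁻¹ * v.1)) -
        ∑ i, (u.2 j i * α i (y.1⁻¹ * v.1) - y.2 j i * α i (y.1⁻¹ * u.1 * (y.1⁻¹ * v.1))) := by
  obtain ⟨f, hf, hf'⟩ := hasFDerivAt_apply_inv_mul hy (βγ j) v.1
  choose g hg hg' using fun i => hasFDerivAt_apply_inv_mul hy (α i) v.1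
  let p (i : Fin 2) : Ambient →L[ℝ] ℝ := LinearMap.toContinuousLinearMap
    (LinearMap.proj i ∘ₗ LinearMap.proj j ∘ₗ LinearMap.snd ℝ Mat (Fin 8 → Fin 2 → ℝ))
  have hp (i : Fin 2) (z : Ambient) : p i z = z.2 j i := rfl
  have h := hf.sub ((((p 0).hasFDerivAt (x := y)).mul (hg 0)).add
    (((p 1).hasFDerivAt (x := y)).mul (hg 1)))
  refine ⟨_, h.congr_of_eventuallyEq (.of_forall fun z => ?_), fun u => ?_⟩
  · refine (θ_apply j v).trans ?_
    rw [Fin.sum_univ_two]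
    rfl
  · change f u - ((p 0 y * g 0 u + α 0 (y.1⁻¹ * v.1) * p 0 u) +
      (p 1 y * g 1 u + α 1 (y.1⁻¹ * v.1) * p 1 u)) = _
    rw [hf', hg', hg', hp, hp, hp, hp, Fin.sum_univ_two]
    ring

theorem differentiableAt_θ (hy : IsUnit y.1) (j : Fin 8) :
    DifferentiableAt ℝ ((system 𝔸).θ j) y := by
  refine differentiableAt_clm_of_apply fun v => ?_
  obtain ⟨_, h, -⟩ := hasFDerivAt_θ_apply (𝔸 := 𝔸) hy j v
  exact h.differentiableAt

theorem differentiableAt_ω (hy : IsUnit y.1) (i : Fin 2) :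
    DifferentiableAt ℝ ((system 𝔸).ω i) y := by
  refine differentiableAt_clm_of_apply fun v => ?_
  obtain ⟨_, h, -⟩ := hasFDerivAt_apply_inv_mul hy (α i) v.1
  exact h.differentiableAt

/-- The torsion term comes from the Maurer-Cartan equation `dω = -ω ∧ ω`, the sum from
differentiating the coefficients of `M`. -/
theorem dθ_apply (hy : IsUnit y.1) (j : Fin 8) (u v : Ambient) :
    (system 𝔸).dθ j y u v = -torsion y.2 (y.1⁻¹ * u.1) (y.1⁻¹ * v.1) j -
      ∑ i, (u.2 j i * α i (y.1⁻¹ * v.1) - v.2 j i * α i (y.1⁻¹ * u.1)) := by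
  obtain ⟨f, hf, hf'⟩ := hasFDerivAt_θ_apply (𝔸 := 𝔸) hy j v
  obtain ⟨g, hg, hg'⟩ := hasFDerivAt_θ_apply (𝔸 := 𝔸) hy j u
  refine (PfaffianSystem.dθ_eq _ (differentiableAt_θ hy j) u v).trans ((congrArg₂ HSub.hSub
    ((DFunLike.congr_fun hf.fderiv u).trans (hf' u))
    ((DFunLike.congr_fun hg.fderiv v).trans (hg' v))).trans ?_)
  rw [torsion]
  simp only [Fin.sum_univ_two, map_sub]
  ring

/-! ### Integral vectors -/

section System

variable {a b₁ b₂ : ℝ}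

theorem isUnit_of_mem_carrier (hy : y ∈ (system 𝔸).carrier) : IsUnit y.1 :=
  isUnit_of_mem_group hy.1

theorem mul_inv_mul_of_mem_carrier (hy : y ∈ (system 𝔸).carrier) (X : Mat) :
    y.1⁻¹ * (y.1 * X) = X :=
  Matrix.nonsing_inv_mul_cancel_left _ _ (isUnit_det_of_mem_group hy.1)

/-- The tangent vector at `y = (g, M)` whose component in `𝔤` is the element of the graph of `M` over
`ξ`, and whose component in `Hom(𝔞, 𝔟)` has parameters `c`. -/
def integralVec (a : ℝ) (y : Ambient) :
    (Fin 2 → ℝ) × (Fin 4 → ℝ) →ₗ[ℝ] Ambient where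
  toFun x := (y.1 * graphElt y.2 x.1, dirMat a x.2)
  map_add' x z := by
    ext1
    · rw [graphElt_eq, graphElt_eq _ x.1, graphElt_eq _ z.1]
      simp only [Prod.fst_add, Pi.add_apply, ← mul_add]
      congr 1
      module
    · exact map_add (dirMat a) _ _
  map_smul' r x := by
    ext1
    · rw [graphElt_eq, graphElt_eq _ x.1]
      simp only [Prod.smul_fst, Pi.smul_apply, RingHom.id_apply, ← mul_smul_comm, smul_eq_mul]
      congr 1
      module
    · exact map_smul (dirMat a) _ _

theorem integralVec_apply (x : (Fin 2 → ℝ) × (Fin 4 → ℝ)) :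
    integralVec a y x = (y.1 * graphElt y.2 x.1, dirMat a x.2) := rfl

theorem graphElt_mem (M : Fin 8 → Fin 2 → ℝ) (ξ : Fin 2 → ℝ) : graphElt M ξ ∈ lieAlg :=
  ofCoords_mem _ _

theorem α_graphElt (M : Fin 8 → Fin 2 → ℝ) (ξ : Fin 2 → ℝ) (i : Fin 2) :
    α i (graphElt M ξ) = ξ i := α_ofCoords _ _ i

theorem βγ_graphElt (M : Fin 8 → Fin 2 → ℝ) (ξ : Fin 2 → ℝ) (j : Fin 8) :
    βγ j (graphElt M ξ) = M j 0 * ξ 0 + M j 1 * ξ 1 := βγ_ofCoords _ _ j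

theorem ω_integralVec (hy : y ∈ (system 𝔸).carrier) (i : Fin 2)
    (x : (Fin 2 → ℝ) × (Fin 4 → ℝ)) : (system 𝔸).ω i y (integralVec a y x) = x.1 i := by
  rw [ω_apply, integralVec_apply, mul_inv_mul_of_mem_carrier hy, α_graphElt]

theorem integralVec_injective (hy : y ∈ (system 𝔸).carrier) :
    Function.Injective (integralVec a y) := by
  intro x z h
  refine Prod.ext (funext fun i => ?_) (dirMat_injective a (congrArg Prod.snd h))
  rw [← ω_integralVec (a := a) hy, h, ω_integralVec hy]

theorem dθ_integralVec (hy : y ∈ (system 𝔸).carrier) (j : Fin 8)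
    (x z : (Fin 2 → ℝ) × (Fin 4 → ℝ)) :
    (system 𝔸).dθ j y (integralVec a y x) (integralVec a y z) =
      -(x.1 0 * z.1 1 - x.1 1 * z.1 0) * graphTorsion y.2 j -
        (dirMat a x.2 j 0 * z.1 0 + dirMat a x.2 j 1 * z.1 1) +
        (dirMat a z.2 j 0 * x.1 0 + dirMat a z.2 j 1 * x.1 1) := by
  rw [dθ_apply (isUnit_of_mem_carrier hy), integralVec_apply, integralVec_apply,
    mul_inv_mul_of_mem_carrier hy, mul_inv_mul_of_mem_carrier hy, torsion_graphElt,
    Fin.sum_univ_two]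
  simp only [α_graphElt]
  ring

local notation "𝒮" => system (affineTableau a b₁ b₂)

/-- The generators fix the coordinates `(β, γ)` in terms of `α`, leaving `α` and the fibre component
free. -/
theorem mem_tangent_and_θ_iff (hy : y ∈ (𝒮).carrier) {v : Ambient} :
    (v ∈ (𝒮).tangent y ∧ ∀ j, (𝒮).θ j y v = 0) ↔ ∃ x, integralVec a y x = v := by
  have hdet := isUnit_det_of_mem_group hy.1
  constructor
  · rintro ⟨hv, hθ⟩
    obtain ⟨hX, c, hc⟩ := (mem_tangent_iff hy).mp hv
    refine ⟨(fun i => α i (y.1⁻¹ * v.1), c), Prod.ext ?_ hc.symm⟩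
    have : graphElt y.2 (fun i => α i (y.1⁻¹ * v.1)) = y.1⁻¹ * v.1 := by
      refine ext_coords (graphElt_mem _ _) hX (fun i => α_graphElt _ _ i) fun j => ?_
      have h := hθ j
      rw [θ_apply, sub_eq_zero, Fin.sum_univ_two] at h
      rw [βγ_graphElt, h]
    rw [integralVec_apply, this, Matrix.mul_nonsing_inv_cancel_left _ _ hdet]
  · rintro ⟨x, rfl⟩
    refine ⟨(mem_tangent_iff hy).mpr ⟨?_, x.2, rfl⟩, fun j => ?_⟩
    · rw [integralVec_apply, mul_inv_mul_of_mem_carrier hy]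
      exact graphElt_mem _ _
    · rw [θ_apply, integralVec_apply, mul_inv_mul_of_mem_carrier hy, βγ_graphElt,
        Fin.sum_univ_two, α_graphElt, α_graphElt, sub_self]

theorem graphTorsion_natAdd (hy : y ∈ (𝒮).carrier) (j : Fin 4) :
    graphTorsion y.2 (Fin.natAdd 4 j) = 0 := by
  obtain ⟨-, q₁, q₂, t, p₂, h⟩ := mem_carrier_iff.mp hy
  rw [h, graphTorsion_coordMat]

/-- Provides dual vectors for proving independence, both of the forms on `Y` and of the
differentials of the equations on `1`-frames. -/
theorem exists_mem_tangent (hy : y ∈ (𝒮).carrier) (p : Fin 2 → ℝ) (r : Fin 8 → ℝ) :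
    ∃ v ∈ (𝒮).tangent y, (∀ i, (𝒮).ω i y v = p i) ∧ ∀ j, (𝒮).θ j y v = r j := by
  set b : Fin 8 → ℝ := fun j => r j + ∑ i, y.2 j i * p i
  refine ⟨(y.1 * ofCoords p b, 0), (mem_tangent_iff hy).mpr ⟨?_, 0, (map_zero _).symm⟩,
    fun i => ?_, fun j => ?_⟩
  · rw [mul_inv_mul_of_mem_carrier hy]
    exact ofCoords_mem _ _
  · rw [ω_apply, mul_inv_mul_of_mem_carrier hy, α_ofCoords]
  · rw [θ_apply, mul_inv_mul_of_mem_carrier hy, βγ_ofCoords]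
    simp only [α_ofCoords, b, add_sub_cancel_right]

theorem finrank_tangent (hy : y ∈ (𝒮).carrier) : Module.finrank ℝ ((𝒮).tangent y) = 14 := by
  let f : lieAlg × (Fin 4 → ℝ) →ₗ[ℝ] Ambient :=
    (LinearMap.mulLeft ℝ y.1 ∘ₗ lieAlg.toSubmodule.subtype).prodMap (dirMat a)
  have hdet := isUnit_det_of_mem_group hy.1
  have hf : Function.Injective f := by
    rintro ⟨X, c⟩ ⟨Y, d⟩ h
    refine Prod.ext (Subtype.ext ?_) (dirMat_injective a (congrArg Prod.snd h))
    have h' : y.1 * (X : Mat) = y.1 * (Y : Mat) := congrArg Prod.fst h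
    rw [← mul_inv_mul_of_mem_carrier hy (X : Mat), h', mul_inv_mul_of_mem_carrier hy]
  have : (𝒮).tangent y = LinearMap.range f := by
    ext v
    rw [mem_tangent_iff hy]
    constructor
    · rintro ⟨hX, c, hc⟩
      exact ⟨(⟨_, hX⟩, c), Prod.ext (Matrix.mul_nonsing_inv_cancel_left _ _ hdet) hc.symm⟩
    · rintro ⟨⟨X, c⟩, rfl⟩
      exact ⟨(mul_inv_mul_of_mem_carrier hy (X : Mat)).symm ▸ X.2, c, rfl⟩
  rw [this, LinearMap.finrank_range_of_inj hf, Module.finrank_prod, coordEquiv.finrank_eq]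
  simp

theorem independentForms : (𝒮).IndependentForms := by
  intro y hy
  choose v hv hω hθ using exists_mem_tangent (a := a) (b₁ := b₁) (b₂ := b₂) hy
  refine linearIndependent_of_dual (Sum.elim
    (fun j => ⟨v 0 (Pi.single j 1), hv _ _⟩) (fun i => ⟨v (Pi.single i 1) 0, hv _ _⟩)) ?_
  rintro (j | i) (k | l)
  · exact (hθ _ _ _).trans (by simp [Pi.single_apply])
  · exact (hθ _ _ _).trans (by simp)
  · exact (hω _ _ _).trans (by simp)
  · exact (hω _ _ _).trans (by simp [Pi.single_apply])

theorem isLinear : (𝒮).IsLinear := by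
  intro y hy u hu v hv hθu hθv hωu hωv j
  obtain ⟨x, rfl⟩ := (mem_tangent_and_θ_iff hy).mp ⟨hu, hθu⟩
  obtain ⟨z, rfl⟩ := (mem_tangent_and_θ_iff hy).mp ⟨hv, hθv⟩
  have hx (i : Fin 2) : x.1 i = 0 := by rw [← ω_integralVec (a := a) hy, hωu]
  have hz (i : Fin 2) : z.1 i = 0 := by rw [← ω_integralVec (a := a) hy, hωv]
  rw [dθ_integralVec hy]
  simp [hx, hz]

end System

/-! ### Polar spaces -/

section Polar

variable {a b₁ b₂ : ℝ} {y : Ambient}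

local notation "𝒮" => system (affineTableau a b₁ b₂)

/-- The four `γ` equations are vacuous: neither the torsion nor the direction has `γ` components.
The remaining four are linear in `z.2`, with the matrix of evaluation at `x.1`. -/
theorem forall_dθ_integralVec_iff (hy : y ∈ (𝒮).carrier) (x z : (Fin 2 → ℝ) × (Fin 4 → ℝ)) :
    (∀ j, (𝒮).dθ j y (integralVec a y x) (integralVec a y z) = 0) ↔
      dirEval a x.1 z.2 = fun j => (x.1 0 * z.1 1 - x.1 1 * z.1 0) *
        graphTorsion y.2 (Fin.castAdd 4 j) + dirEval a z.1 x.2 j := by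
  constructor
  · intro h
    ext j
    have := h (Fin.castAdd 4 j)
    rw [dθ_integralVec hy] at this
    simp only [dirEval, LinearMap.coe_mk, AddHom.coe_mk]
    linarith
  · intro h j
    rw [dθ_integralVec hy]
    refine Fin.addCases (m := 4) (n := 4) (fun j => ?_) (fun j => ?_) j
    · have := congrFun h j
      simp only [dirEval, LinearMap.coe_mk, AddHom.coe_mk] at this
      linarith
    · rw [graphTorsion_natAdd hy]
      simp only [dirMat_natAdd]
      ring

theorem mem_polar_one_iff (hy : y ∈ (𝒮).carrier) {x : (Fin 2 → ℝ) × (Fin 4 → ℝ)}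
    {e : Fin 1 → Ambient} (he : e 0 = integralVec a y x) {v : Ambient} :
    v ∈ (𝒮).polar (y, e) ↔ ∃ z, integralVec a y z = v ∧
      ∀ j, (𝒮).dθ j y (integralVec a y x) (integralVec a y z) = 0 := by
  constructor
  · rintro ⟨hv, hθ, hd⟩
    obtain ⟨z, rfl⟩ := (mem_tangent_and_θ_iff hy).mp ⟨hv, hθ⟩
    exact ⟨z, rfl, fun j => he ▸ hd j 0⟩
  · rintro ⟨z, rfl, hd⟩
    obtain ⟨hv, hθ⟩ := (mem_tangent_and_θ_iff hy).mpr ⟨z, rfl⟩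
    refine ⟨hv, hθ, fun j i => ?_⟩
    rw [Subsingleton.elim i 0]
    exact (congrArg (fun w => (𝒮).dθ j y w (integralVec a y z)) he).trans (hd j)

/-- Over each value of `(α¹, α²)` the polar equations have exactly one solution `d`, so the polar
space projects isomorphically onto `ℝ²`. -/
theorem finrank_polar_one (hy : y ∈ (𝒮).carrier) {x : (Fin 2 → ℝ) × (Fin 4 → ℝ)}
    {e : Fin 1 → Ambient} (he : e 0 = integralVec a y x) (hx : charForm a x.1 ≠ 0) :
    Module.finrank ℝ ((𝒮).polar (y, e)) = 2 := by
  let f : (𝒮).polar (y, e) →ₗ[ℝ] (Fin 2 → ℝ) :=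
    LinearMap.pi fun i => ((𝒮).ω i y).toLinearMap.domRestrict ((𝒮).polar (y, e))
  have hf : Function.Bijective f := by
    constructor
    · rw [injective_iff_map_eq_zero]
      rintro ⟨v, hv⟩ h
      obtain ⟨z, rfl, hd⟩ := (mem_polar_one_iff hy he).mp hv
      have hz : z.1 = 0 := by
        ext i
        rw [← ω_integralVec (a := a) hy]
        exact congrFun h i
      rw [forall_dθ_integralVec_iff hy, hz] at hd
      have hz' : z.2 = 0 := dirEval_injective hx <| by
        rw [hd, map_zero]
        ext j
        simp [dirEval]
      refine Subtype.ext ?_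
      exact (congrArg (integralVec a y) (Prod.ext hz hz' : z = 0)).trans (map_zero _)
    · intro η
      obtain ⟨d, hd⟩ := dirEval_surjective hx fun j => (x.1 0 * η 1 - x.1 1 * η 0) *
        graphTorsion y.2 (Fin.castAdd 4 j) + dirEval a η x.2 j
      refine ⟨⟨integralVec a y (η, d), (mem_polar_one_iff hy he).mpr
        ⟨_, rfl, (forall_dθ_integralVec_iff hy _ _).mpr hd⟩⟩, ?_⟩
      ext i
      exact ω_integralVec hy i (η, d)
  rw [(LinearEquiv.ofBijective f hf).finrank_eq, Module.finrank_fin_fun]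

theorem finrank_polar_zero (hy : y ∈ (𝒮).carrier) (e : Fin 0 → Ambient) :
    Module.finrank ℝ ((𝒮).polar (y, e)) = 6 := by
  have : (𝒮).polar (y, e) = LinearMap.range (integralVec a y) := by
    ext v
    refine Iff.trans ?_ (mem_tangent_and_θ_iff hy)
    exact ⟨fun h => ⟨h.1, h.2.1⟩, fun h => ⟨h.1, h.2, fun _ i => i.elim0⟩⟩
  rw [this, LinearMap.finrank_range_of_inj (integralVec_injective hy), Module.finrank_prod]
  simp

/-! ### Regularity -/

theorem exists_integralVec_of_isIntegral {p : ℕ} {z : Ambient × (Fin p → Ambient)}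
    (hz : (𝒮).IsIntegral z) (i : Fin p) : ∃ x, integralVec a z.1 x = z.2 i :=
  (mem_tangent_and_θ_iff hz.1.1).mp ⟨hz.1.2.2 i, fun j => hz.2 (.inl (j, i))⟩

theorem isKahlerRegular_zero (hy : y ∈ (𝒮).carrier) (e : Fin 0 → Ambient) :
    (𝒮).IsKahlerRegular (y, e) := by
  refine ⟨⟨⟨hy, linearIndependent_empty_type, fun i => i.elim0⟩, ?_, 0, Fin.elim0, ?_,
    linearIndependent_empty_type⟩, ?_⟩
  · rintro (⟨_, i⟩ | ⟨_, i, _⟩) <;> exact i.elim0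
  · refine .of_forall fun z' _ => ?_
    rintro (⟨_, i⟩ | ⟨_, i, _⟩) <;> exact i.elim0
  · filter_upwards [self_mem_nhdsWithin] with z' hz' _
    rw [finrank_polar_zero hy, finrank_polar_zero hz'.1]

/-- The equations from `dθ` are trivial on a single vector, so the eight from `θ` suffice. Varying
the frame vector alone, within the tangent space, already shows that their differentials are
independent. -/
theorem isOrdinaryZero_one {z : Ambient × (Fin 1 → Ambient)} (hz : (𝒮).IsIntegral z) :
    IsOrdinaryZero ((𝒮).frames 1) ((𝒮).integralEqs 1) z := by
  refine ⟨hz.1, hz.2, 8, fun j => .inl (j, 0), .of_forall fun z' h => ?_, ?_⟩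
  · rintro (⟨j, i⟩ | ⟨j, i, k⟩)
    · rw [Subsingleton.elim i 0]
      exact h j
    · rw [Subsingleton.elim i 0, Subsingleton.elim k 0]
      exact PfaffianSystem.dθ_self _ _
  · have hy : z.1 ∈ (𝒮).carrier := hz.1.1
    choose v hv hω hθ using exists_mem_tangent (a := a) (b₁ := b₁) (b₂ := b₂) hy
    have hmem (u : Ambient) (hu : u ∈ (𝒮).tangent z.1) :
        ((0, fun _ => u) : Ambient × (Fin 1 → Ambient)) ∈ embTangent ((𝒮).frames 1) z := by
      have hγ := hasDerivAt_add_smul z ((0, fun _ => u) : Ambient × (Fin 1 → Ambient))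
      have hne : ∀ᶠ t : ℝ in 𝓝 0, (z.2 0 + t • u : Ambient) ≠ 0 := by
        have hc : Continuous fun t : ℝ => (z.2 0 + t • u : Ambient) := by fun_prop
        refine hc.continuousAt.eventually_ne ?_
        rw [zero_smul, add_zero]
        exact hz.1.2.1.ne_zero 0
      have h := mem_embTangent_of_hasDerivAt (Z := (𝒮).frames 1) hγ <| by
        filter_upwards [hne] with t ht
        have e1 : (z + t • ((0, fun _ => u) : Ambient × (Fin 1 → Ambient))).1 = z.1 := by simp
        refine ⟨by rwa [e1], ?_, fun i => ?_⟩
        · refine linearIndependent_unique_iff.mpr ?_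
          simpa using ht
        · rw [e1]
          exact add_mem (hz.1.2.2 i) (Submodule.smul_mem _ t hu)
      simpa using h
    refine linearIndependent_of_dual (fun k => ⟨(0, fun _ => v 0 (Pi.single k 1)),
      hmem _ (hv _ _)⟩) fun j k => ?_
    have hd := ((differentiableAt_θ (𝔸 := affineTableau a b₁ b₂) (isUnit_of_mem_carrier hy)
      j).hasFDerivAt.comp z hasFDerivAt_fst).clm_apply
        (((ContinuousLinearMap.proj (R := ℝ) (φ := fun _ : Fin 1 => Ambient) 0).comp
          (ContinuousLinearMap.snd ℝ Ambient (Fin 1 → Ambient))).hasFDerivAt (x := z))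
    refine (DFunLike.congr_fun hd.fderiv _).trans ?_
    change (𝒮).θ j z.1 (v 0 (Pi.single k 1)) + fderiv ℝ ((𝒮).θ j) z.1 0 (z.2 0) = _
    rw [map_zero]
    exact (add_zero _).trans ((hθ _ _ _).trans (by simp [Pi.single_apply]))

theorem continuousAt_charForm {z : Ambient × (Fin 1 → Ambient)} (hz : z.1 ∈ (𝒮).carrier) :
    ContinuousAt (fun z : Ambient × (Fin 1 → Ambient) =>
      charForm a fun i => (𝒮).ω i z.1 (z.2 0)) z := by
  have h (i : Fin 2) : ContinuousAt
      (fun z : Ambient × (Fin 1 → Ambient) => (𝒮).ω i z.1 (z.2 0)) z := by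
    have h1 : ContinuousAt (fun z : Ambient × (Fin 1 → Ambient) => (𝒮).ω i z.1) z :=
      (differentiableAt_ω (𝔸 := affineTableau a b₁ b₂) (isUnit_of_mem_carrier hz)
        i).continuousAt.comp continuousAt_fst
    have h2 : ContinuousAt (fun z : Ambient × (Fin 1 → Ambient) => z.2 0) z := by fun_prop
    exact h1.clm_apply h2
  exact (continuousAt_const.mul ((h 0).pow 2)).add (continuousAt_const.mul ((h 1).pow 2))

theorem isKahlerRegular_one {z : Ambient × (Fin 1 → Ambient)} (hz : (𝒮).IsIntegral z)
    (hc : charForm a (fun i => (𝒮).ω i z.1 (z.2 0)) ≠ 0) : (𝒮).IsKahlerRegular z := by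
  have key (z' : Ambient × (Fin 1 → Ambient)) (hz' : (𝒮).IsIntegral z')
      (hc' : charForm a (fun i => (𝒮).ω i z'.1 (z'.2 0)) ≠ 0) :
      Module.finrank ℝ ((𝒮).polar z') = 2 := by
    obtain ⟨x, hx⟩ := exists_integralVec_of_isIntegral hz' 0
    refine finrank_polar_one hz'.1.1 hx.symm ?_
    simp only [← hx, ω_integralVec hz'.1.1] at hc'
    exact hc'
  refine ⟨isOrdinaryZero_one hz, ?_⟩
  filter_upwards [nhdsWithin_le_nhds ((continuousAt_charForm hz.1.1).eventually_ne hc)]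
    with z' hc' hz'
  rw [key z hz hc, key z' hz' hc']

theorem integralVec_ne_zero (hy : y ∈ (𝒮).carrier) {x : (Fin 2 → ℝ) × (Fin 4 → ℝ)}
    (hx : charForm a x.1 ≠ 0) : integralVec a y x ≠ 0 := by
  intro h
  obtain rfl : x = 0 := integralVec_injective hy (by rw [h, map_zero])
  exact hx (by simp [charForm])

theorem isIntegral_one (hy : y ∈ (𝒮).carrier) {x : (Fin 2 → ℝ) × (Fin 4 → ℝ)}
    (hx : charForm a x.1 ≠ 0) :
    (𝒮).IsIntegral ((y, fun _ => integralVec a y x) : Ambient × (Fin 1 → Ambient)) := by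
  obtain ⟨hv, hθ⟩ := (mem_tangent_and_θ_iff hy).mpr ⟨x, rfl⟩
  refine ⟨⟨hy, linearIndependent_unique_iff.mpr (integralVec_ne_zero hy hx), fun _ => hv⟩, ?_⟩
  rintro (⟨j, i⟩ | ⟨j, i, k⟩)
  · exact hθ j
  · exact PfaffianSystem.dθ_self _ _

/-- Regularity makes the polar dimension locally constant on integral elements, and
noncharacteristic lines, where it is `2`, accumulate at every integral line. -/
theorem finrank_polar_of_isKahlerRegular {z : Ambient × (Fin 1 → Ambient)}
    (hz : (𝒮).IsKahlerRegular z) : Module.finrank ℝ ((𝒮).polar z) = 2 := by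
  obtain ⟨⟨hz₁, hz₂, -⟩, hev⟩ := hz
  obtain ⟨y, e⟩ := z
  have hy : y ∈ (𝒮).carrier := hz₁.1
  obtain ⟨x, hx⟩ := exists_integralVec_of_isIntegral (z := (y, e)) ⟨hz₁, hz₂⟩ 0
  by_cases hc : charForm a x.1 = 0
  swap
  · exact finrank_polar_one hy hx.symm hc
  obtain ⟨ξ, hξ⟩ := exists_charForm_ne_zero a
  set w : ℝ → (Fin 2 → ℝ) × (Fin 4 → ℝ) := fun t => x + t • (ξ, 0) with hw
  set γ : ℝ → Ambient × (Fin 1 → Ambient) := fun t => (y, fun _ => integralVec a y (w t)) with hγ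
  have hγ0 : γ 0 = (y, e) := by
    refine Prod.ext rfl (funext fun i => ?_)
    rw [Subsingleton.elim i 0]
    simp only [hγ, hw, zero_smul, add_zero, hx]
  have hcont : Continuous γ := by
    have h := LinearMap.continuous_of_finiteDimensional (integralVec a y)
    have hw' : Continuous w := by fun_prop
    exact continuous_const.prodMk (continuous_pi fun _ => h.comp hw')
  -- `B` is the polarization of `charForm a` at `x.1` and `ξ`. Along the line `w` the form is
  -- quadratic in `t` with leading coefficient `charForm a ξ ≠ 0`, hence nonzero for small `t ≠ 0`.
  set B := Real.cos a * x.1 0 * ξ 0 + Real.sin a * x.1 1 * ξ 1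
  have hform (t : ℝ) : charForm a (w t).1 = t * (2 * B + t * charForm a ξ) := by
    have : charForm a (w t).1 = charForm a x.1 + t * (2 * B + t * charForm a ξ) := by
      simp only [charForm, hw, Prod.fst_add, Prod.smul_fst, Pi.add_apply, Pi.smul_apply,
        smul_eq_mul, B]
      ring
    rw [this, hc, zero_add]
  have hne : ∀ᶠ t : ℝ in 𝓝[≠] 0, charForm a (w t).1 ≠ 0 := by
    have h2 : ∀ᶠ t : ℝ in 𝓝[≠] 0, t ≠ -(2 * B) / charForm a ξ := by
      by_cases h0 : -(2 * B) / charForm a ξ = 0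
      · rw [h0]
        exact self_mem_nhdsWithin
      · exact nhdsWithin_le_nhds (isOpen_ne.mem_nhds (Ne.symm h0))
    filter_upwards [self_mem_nhdsWithin, h2] with t ht ht2 h
    rw [hform] at h
    refine (mul_eq_zero.mp h).elim ht fun h' => ht2 ?_
    rw [eq_div_iff hξ]
    linarith
  have htend : Filter.Tendsto γ (𝓝[≠] 0) (𝓝[(𝒮).frames 1] (y, e)) := by
    refine tendsto_nhdsWithin_iff.mpr ⟨?_, ?_⟩
    · rw [← hγ0]
      exact hcont.continuousAt.mono_left nhdsWithin_le_nhds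
    · filter_upwards [hne] with t ht using (isIntegral_one hy ht).1
  obtain ⟨t, ht, ht'⟩ := (hne.and (htend.eventually hev)).exists
  rw [← ht' (isIntegral_one hy ht)]
  exact finrank_polar_one hy rfl ht

/-! ### Involution and Cartan characters -/

theorem inInvolution : (𝒮).InInvolution := by
  intro y hy
  obtain ⟨ξ, hξ⟩ := exists_charForm_ne_zero a
  -- `η` is `ξ` rotated by a right angle, so the independence condition becomes `ξ₀² + ξ₁² ≠ 0`; `d`
  -- then solves the polar equations of the first vector over `η`.
  set η : Fin 2 → ℝ := ![-ξ 1, ξ 0] with hη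
  obtain ⟨d, hd⟩ := dirEval_surjective hξ fun j => (ξ 0 * η 1 - ξ 1 * η 0) *
    graphTorsion y.2 (Fin.castAdd 4 j) + dirEval a η 0 j
  set x : Fin 2 → (Fin 2 → ℝ) × (Fin 4 → ℝ) := ![(ξ, 0), (η, d)] with hx
  have hdθ : ∀ j, (𝒮).dθ j y (integralVec a y (ξ, 0)) (integralVec a y (η, d)) = 0 :=
    (forall_dθ_integralVec_iff hy _ _).mpr hd
  have hdθ' (j : Fin 8) : (𝒮).dθ j y (integralVec a y (η, d)) (integralVec a y (ξ, 0)) = 0 := by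
    have h := hdθ j
    rw [dθ_integralVec hy] at h ⊢
    linarith
  have hdet := sq_add_sq_ne_zero_of_charForm_ne_zero hξ
  have hmem (i : Fin 2) := (mem_tangent_and_θ_iff hy).mpr ⟨x i, rfl⟩
  refine ⟨fun i => integralVec a y (x i), ⟨⟨hy, ?_, fun i => (hmem i).1⟩, ?_⟩, ?_, ?_⟩
  · have hli : LinearIndependent ℝ x := by
      rw [hx, LinearIndependent.pair_iff]
      intro s t h
      have h0 : s * ξ 0 + t * -ξ 1 = 0 := congrFun (congrArg Prod.fst h) 0
      have h1 : s * ξ 1 + t * ξ 0 = 0 := congrFun (congrArg Prod.fst h) 1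
      constructor
      · refine (mul_eq_zero_iff_right hdet).mp ?_
        linear_combination ξ 0 * h0 + ξ 1 * h1
      · refine (mul_eq_zero_iff_right hdet).mp ?_
        linear_combination ξ 0 * h1 - ξ 1 * h0
    exact hli.map' (integralVec a y) (LinearMap.ker_eq_bot.mpr (integralVec_injective hy))
  · rintro (⟨j, i⟩ | ⟨j, i, k⟩)
    · exact (hmem i).2 j
    · fin_cases i <;> fin_cases k
      · exact PfaffianSystem.dθ_self _ _
      · exact hdθ j
      · exact hdθ' j
      · exact PfaffianSystem.dθ_self _ _
  · rw [Matrix.det_fin_two]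
    simp only [Matrix.of_apply, ω_integralVec hy, hx, hη, Matrix.cons_val_zero,
      Matrix.cons_val_one]
    intro h
    exact hdet (by linarith)
  · intro k hk
    interval_cases k
    · exact isKahlerRegular_zero hy _
    · have e1 : PfaffianSystem.trunc y (fun i => integralVec a y (x i)) 1 hk.le =
          (y, fun _ => integralVec a y (ξ, 0)) :=
        Prod.ext rfl (funext fun i => by rw [Subsingleton.elim i 0]; rfl)
      rw [e1]
      refine isKahlerRegular_one (isIntegral_one hy (x := (ξ, 0)) hξ) ?_
      simp only [ω_integralVec hy]
      exact hξ

theorem hasCartanCharacters : (𝒮).HasCartanCharacters ![8, 4, 0] := by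
  intro y hy e he k
  have h0 : (𝒮).polarCodim y e 0 = 8 := by
    rw [PfaffianSystem.polarCodim, dif_pos (by norm_num), finrank_tangent hy]
    have h := finrank_polar_zero hy (PfaffianSystem.trunc y e 0 (by norm_num)).2
    rw [show Module.finrank ℝ ((𝒮).polar (PfaffianSystem.trunc y e 0 (by norm_num))) = 6 from h]
    norm_num
  have h1 : (𝒮).polarCodim y e 1 = 12 := by
    rw [PfaffianSystem.polarCodim, dif_pos (by norm_num), finrank_tangent hy,
      finrank_polar_of_isKahlerRegular (he.2.2 1 (by norm_num))]
    norm_num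
  -- For `k = n` the codimension is that of the integral plane itself, `14 - 2`.
  have h2 : (𝒮).polarCodim y e 2 = 12 := by
    rw [PfaffianSystem.polarCodim, dif_neg (by norm_num), finrank_tangent hy]
    norm_num
  fin_cases k
  · exact h0
  · change (𝒮).polarCodim y e 1 - (𝒮).polarCodim y e 0 = 4
    rw [h0, h1]
    norm_num
  · change (𝒮).polarCodim y e 2 - (𝒮).polarCodim y e 1 = 0
    rw [h1, h2]
    norm_num

end Polar

end Moebius

end

theorem mainTheorem3 (a b₁ b₂ : ℝ) :
    (Module.finrank ℝ (Moebius.affineTableau a b₁ b₂).direction = 4 ∧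
      Tableau.IsInvolutiveAffine (Moebius.affineTableau a b₁ b₂) ∧
      Tableau.character (Moebius.affineTableau a b₁ b₂).direction 1 = 4 ∧
      Tableau.character (Moebius.affineTableau a b₁ b₂).direction 2 = 0) ∧
    Tableau.IsAffineTableauOver Moebius.isCompl (Moebius.affineTableau a b₁ b₂) ∧
    ((Moebius.system (Moebius.affineTableau a b₁ b₂)).IndependentForms ∧
      (Moebius.system (Moebius.affineTableau a b₁ b₂)).IsLinear ∧
      (Moebius.system (Moebius.affineTableau a b₁ b₂)).InInvolution ∧
      (Moebius.system (Moebius.affineTableau a b₁ b₂)).HasCartanCharacters ![8, 4, 0]) := by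
  refine ⟨⟨?_, Moebius.isInvolutiveAffine a b₁ b₂, ?_, ?_⟩, Moebius.isAffineTableauOver a b₁ b₂,
    Moebius.independentForms, Moebius.isLinear, Moebius.inInvolution,
    Moebius.hasCartanCharacters⟩
  · rw [Moebius.direction_affineTableau, Moebius.finrank_range_dirMap]
  · rw [Moebius.direction_affineTableau, Moebius.character_one]
  · rw [Moebius.direction_affineTableau, Moebius.character_two]
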